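/- Let $K$ be a field. A simplicial complex $\Delta$ on a finite vertex set $V$ is a collection of subsets of $V$ closed under taking subsets (singletons need not be faces). For $S=K[x_j : j\in V]$ let $I_\Delta\subseteq S$ be the ideal generated by the monomials $x_N=\prod_{j\in N}x_j$ with $N\notin\Delta$, and put $K[\Delta]=S/I_\Delta$. Let $T^1(\Delta)$ be the cokernel of the natural map $\mathrm{Der}_K(S)\to \mathrm{Hom}_S(I_\Delta,K[\Delta])$, $\partial\mapsto (f\mapsto \partial f+I_\Delta)$, with its $\mathbb Z^V$-grading. For a squarefree monomial ideal $I\subseteq S$ and a new variable $y$, a monomial ideal $J\subseteq S[y]$ is a separation of $I$ for the variable $x_i$ if (i) $I$ is the image of $J$ under the $K$-algebra homomorphism $S[y]\to S$ with $y\mapsto x_i$ and $x_j\mapsto x_j$ for all $j\in V$; (ii) $x_i$ divides some minimal monomial generator of $J$, and $y$ divides some minimal monomial generator of $J$; (iii) $y-x_i$ is a non-zero-divisor on $S[y]/J$. **Proposition.** Let $\Delta$ be a simplicial complex on $[n]$, let $i\in[n]$, and suppose that $\dim_K T^1(\Delta)_{-e_i}=k$, where $k\ge 0$ is an integer. Then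 there is a simplicial complex $\widetilde\Delta$ on the vertex set $([n]\setminus\{i\})\cup\{v_0,\dots,v_k\}$ (with $v_0,\dots,v_k$ new distinct elements, and with variables $y_0,\dots,y_k$ corresponding to $v_0,\dots,v_k$) such that: 1. $I_{\widetilde\Delta}$ is obtained from $I_\Delta$ by $k$ successive separations for the variable $x_i$. That is, there are ideals $L_m\subseteq K[x_j\ (j\ne i),y_0,\dots,y_m]$ for $0\le m\le k$ such that $L_0$ is $I_\Delta$ with $x_i$ renamed to $y_0$, $L_{m+1}$ is a separation of $L_m$ for the variable $y_0$ with new variable $y_{m+1}$ for $0\le m<k$, and $L_k=I_{\widetilde\Delta}$. 2. The sequence $y_1-y_0,\,y_2-y_1,\dots,y_k-y_{k-1}$ is weakly regular on $K[\widetilde\Delta]$ (each element is a non-zero-divisor modulo its predecessors), and it is a regular sequence on $K[\widetilde\Delta]$ (the quotient is moreover nonzero) if $\emptyset\in\Delta$. The substitution $y_\ell\mapsto x_i$ ($0\le \ell\le k$), $x_j\mapsto x_j$ ($j\neq i$) induces an isomorphism of $K$-algebras $K[\widetilde\Delta]/(y_1-y_0,\dots,y_k-y_{k-1})\cong K[\Delta]$.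 3. $T^1(\widetilde\Delta)_{-b}=0$ for every vector $b$ of non-negative integers, indexed by the vertices of $\widetilde\Delta$, with $\mathrm{supp}\, b\subseteq\{v_0,\dots,v_k\}$. -/

import Mathlib

open MvPolynomial

noncomputable section

/-- A simplicial complex on the vertex set `V`: a collection of subsets of `V`, closed under
passing to subsets. Elements of `V` need not be faces. -/
abbrev SimplicialComplexOn (V : Type*) := LowerSet (Finset V)

/-- The Stanley-Reisner ideal, generated by the monomials `x_N` of the non-faces `N`. -/
def stanleyReisnerIdeal (K : Type*) [Field K] {V : Type*} (Δ : SimplicialComplexOn V) :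
    Ideal (MvPolynomial V K) :=
  Ideal.span {f | ∃ N : Finset V, N ∉ Δ ∧ f = ∏ j ∈ N, X j}

/-- The Stanley-Reisner ring `K[Δ]`. -/
abbrev StanleyReisnerRing (K : Type*) [Field K] {V : Type*} (Δ : SimplicialComplexOn V) :=
  MvPolynomial V K ⧸ stanleyReisnerIdeal K Δ

section Cotangent

variable {K : Type*} [Field K] {V : Type*}

/-- The homomorphism `I → S/I`, `f ↦ ∂f + I` given by a derivation `∂` of `S`. -/
def derivationToHom (I : Ideal (MvPolynomial V K))
    (D : Derivation K (MvPolynomial V K) (MvPolynomial V K)) :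
    I →ₗ[MvPolynomial V K] MvPolynomial V K ⧸ I where
  toFun f := Ideal.Quotient.mk I (D (f : MvPolynomial V K))
  map_add' f g := by simp
  map_smul' s f := by
    have hf : Ideal.Quotient.mk I (f : MvPolynomial V K) = 0 :=
      Ideal.Quotient.eq_zero_iff_mem.mpr f.2
    simp [hf]
    rfl

/-- The natural map `δ* : Der_K(S) → Hom_S(I, S/I)`. -/
def deltaStar (I : Ideal (MvPolynomial V K)) :
    Derivation K (MvPolynomial V K) (MvPolynomial V K) →ₗ[MvPolynomial V K]
      (I →ₗ[MvPolynomial V K] MvPolynomial V K ⧸ I) where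
  toFun D := derivationToHom I D
  map_add' D E := by
    ext f
    simp [derivationToHom]
  map_smul' s D := by
    ext f
    simp [derivationToHom]
    rfl

/-- The first cotangent module `T¹(S/I)`, the cokernel of `δ*`. -/
abbrev T1 (I : Ideal (MvPolynomial V K)) :=
  (I →ₗ[MvPolynomial V K] MvPolynomial V K ⧸ I) ⧸ LinearMap.range (deltaStar I)

/-- The component of degree `c ∈ ℤ^V` of `S/I`, for a monomial ideal `I`: it is spanned by the
class of `x^c` if `c` has no negative entry, and it is `0` otherwise. -/
def quotientDegree (I : Ideal (MvPolynomial V K)) (c : V → ℤ) :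
    Submodule K (MvPolynomial V K ⧸ I) :=
  Submodule.span K
    {q | ∃ u : V →₀ ℕ, (∀ j, (u j : ℤ) = c j) ∧ q = Ideal.Quotient.mk I (monomial u 1)}

/-- The component of degree `c ∈ ℤ^V` of `Hom_S(I, S/I)`, for a monomial ideal `I`: the
homomorphisms that raise the multidegree by `c`. -/
def homDegree (I : Ideal (MvPolynomial V K)) (c : V → ℤ) :
    Submodule K (I →ₗ[MvPolynomial V K] MvPolynomial V K ⧸ I) where
  carrier := {φ | ∀ (u : V →₀ ℕ) (h : monomial u (1 : K) ∈ I),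
    φ ⟨monomial u 1, h⟩ ∈ quotientDegree I (fun j => (u j : ℤ) + c j)}
  add_mem' hφ hψ u h := Submodule.add_mem _ (hφ u h) (hψ u h)
  zero_mem' _ _ := Submodule.zero_mem _
  smul_mem' a _ hφ u h := Submodule.smul_mem _ a (hφ u h)

/-- The component `T¹(S/I)_c` of degree `c ∈ ℤ^V`, for a monomial ideal `I`. -/
def T1Degree (I : Ideal (MvPolynomial V K)) (c : V → ℤ) : Submodule K (T1 I) :=
  (homDegree I c).map ((LinearMap.range (deltaStar I)).mkQ.restrictScalars K)

end Cotangent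

section Separation

variable {K : Type*} [Field K] {V : Type*}

/-- An ideal generated by monomials. -/
def IsMonomialIdeal (I : Ideal (MvPolynomial V K)) : Prop :=
  ∃ s : Set (V →₀ ℕ), I = Ideal.span ((fun u => monomial u (1 : K)) '' s)

/-- An ideal generated by squarefree monomials. -/
def IsSquarefreeMonomialIdeal (I : Ideal (MvPolynomial V K)) : Prop :=
  ∃ s : Set (V →₀ ℕ), (∀ u ∈ s, ∀ j, u j ≤ 1) ∧
    I = Ideal.span ((fun u => monomial u (1 : K)) '' s)

/-- `x^u` belongs to the minimal set of monomial generators of the monomial ideal `I`. -/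
def IsMinimalGenerator (I : Ideal (MvPolynomial V K)) (u : V →₀ ℕ) : Prop :=
  monomial u (1 : K) ∈ I ∧ ∀ w : V →₀ ℕ, w ≤ u → monomial w (1 : K) ∈ I → w = u

/-- `J ⊆ S[y]` is a separation of the squarefree monomial ideal `I ⊆ S` for the variable `x_i`.
The variables of `S[y]` are indexed by `Option V`, the index of `y` being `none`. -/
structure IsSeparation (I : Ideal (MvPolynomial V K)) (i : V)
    (J : Ideal (MvPolynomial (Option V) K)) : Prop where
  squarefree : IsSquarefreeMonomialIdeal I
  isMonomial : IsMonomialIdeal J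
  image : J.map (rename (R := K) (fun o : Option V => o.elim i id)) = I
  dvd_xi : ∃ u, IsMinimalGenerator J u ∧ u (some i) ≠ 0
  dvd_y : ∃ u, IsMinimalGenerator J u ∧ u none ≠ 0
  regular : Ideal.Quotient.mk J (X none - X (some i)) ∈
    nonZeroDivisors (MvPolynomial (Option V) K ⧸ J)

variable [DecidableEq V]

/-- The vertex set `(V \ {i}) ∪ {v_0, …, v_m}`. -/
abbrev SplitVertices (i : V) (m : ℕ) := {j : V // j ≠ i} ⊕ Fin (m + 1)

/-- The bijection `V → (V \ {i}) ∪ {v_0}` that replaces `i` by `v_0`. -/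
def relabelVertex (i : V) (j : V) : SplitVertices i 0 :=
  if h : j = i then Sum.inr 0 else Sum.inl ⟨j, h⟩

/-- The bijection from `(V \ {i}) ∪ {v_0, …, v_m}` with one new element adjoined to
`(V \ {i}) ∪ {v_0, …, v_{m+1}}`, the new element becoming `v_{m+1}`. -/
def adjoinVertex (i : V) (m : ℕ) : Option (SplitVertices i m) → SplitVertices i (m + 1)
  | none => Sum.inr (Fin.last (m + 1))
  | some (Sum.inl j) => Sum.inl j
  | some (Sum.inr l) => Sum.inr l.castSucc

/-- The map from `(V \ {i}) ∪ {v_0, …, v_m}` to `V` that sends every `v_l` to `i`. -/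
def collapseVertex (i : V) (m : ℕ) : SplitVertices i m → V :=
  Sum.elim (fun j => (j : V)) (fun _ => i)

/-- `J` arises from `I` by `k` successive separations for the variable `x_i`: after renaming `x_i`
to `v_0`, the `m`-th step is a separation for `v_0` with new variable `v_m`. -/
def IsIteratedSeparation (I : Ideal (MvPolynomial V K)) (i : V) (k : ℕ)
    (J : Ideal (MvPolynomial (SplitVertices i k) K)) : Prop :=
  ∃ L : (m : ℕ) → Ideal (MvPolynomial (SplitVertices i m) K),
    L 0 = I.map (rename (R := K) (relabelVertex i)) ∧
    (∀ m < k, IsSeparation (L m) (Sum.inr 0)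
      ((L (m + 1)).comap (rename (R := K) (adjoinVertex i m)))) ∧
    L k = J

/-- The sequence `v_1 - v_0, …, v_k - v_{k-1}` in `K[Δ']`, for a simplicial complex `Δ'` on
`(V \ {i}) ∪ {v_0, …, v_k}`. -/
def differenceSequence (K : Type*) [Field K] (i : V) (k : ℕ)
    (Δ' : SimplicialComplexOn (SplitVertices i k)) : List (StanleyReisnerRing K Δ') :=
  List.ofFn fun l : Fin k =>
    Ideal.Quotient.mk (stanleyReisnerIdeal K Δ') (X (Sum.inr l.succ) - X (Sum.inr l.castSucc))

end Separation

end

/-! Join two minimal non-faces `N`, `N'` through `i` by an edge when `(N ∪ N') \ i` is a face. A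
homomorphism of degree `-e_i` sends `x_N` to `λ_N x_(N \ i)` for `N` through `i` and to `0`
otherwise. Evaluating it on `x_(N ∪ N')` in two ways forces `λ_N = λ_N'` along edges, and there are
no further conditions. The image of the derivations consists of the constant `λ`. Hence the
dimension of `T¹` in degree `-e_i` is the number of components minus one, or `0` if there are no
components (`card_linkComponents`).

The `k + 1` components are used as colours, and `x_i` is replaced in each generator by the variable
of its colour. If two generators have different colours, `(N ∪ N') \ i` contains a generator without
`i`. This makes `y_a - y_b` a non-zero-divisor (`IsSeparating.mem_of_X_sub_X_mul`). The condition
survives any merging of colours, so this single fact gives both the successive separations and the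
regular sequence.

In the new ideal the graph at `v_a` is the component `a`, which is connected, so `T¹` vanishes in
degree `-e_(v_a)`. A generator contains at most one new vertex, so there are no nonzero
homomorphisms in the other degrees `-b` (`T1Degree_splitFamily_eq_bot`). -/

noncomputable section

/-! ### Squarefree monomial ideals and a non-zero-divisor criterion. -/

section SquarefreeIdeal

variable {K : Type*} [Field K] {W W' : Type*}

/-- The indicator exponent vector of `G`. -/
def vertexExponent (G : Finset W) : W →₀ ℕ := Finsupp.indicator G fun _ _ => 1

open Classical in
lemma vertexExponent_apply (G : Finset W) (v : W) :
    vertexExponent G v = if v ∈ G then 1 else 0 := by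
  simp [vertexExponent, Finsupp.indicator_apply]

lemma vertexExponent_of_mem {G : Finset W} {v : W} (h : v ∈ G) : vertexExponent G v = 1 := by
  simp [vertexExponent_apply, h]

lemma vertexExponent_of_notMem {G : Finset W} {v : W} (h : v ∉ G) : vertexExponent G v = 0 := by
  simp [vertexExponent_apply, h]

lemma vertexExponent_le_iff {G : Finset W} {u : W →₀ ℕ} :
    vertexExponent G ≤ u ↔ G ⊆ u.support := by
  classical
  rw [Finsupp.le_def]
  refine ⟨fun h v hv => ?_, fun h v => ?_⟩
  · have := h v
    rw [vertexExponent_of_mem hv] at this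
    simp; omega
  · by_cases hv : v ∈ G
    · have := h hv
      rw [vertexExponent_of_mem hv]
      simp at this; omega
    · simp [vertexExponent_of_notMem hv]

lemma support_vertexExponent (G : Finset W) : (vertexExponent G).support = G := by
  classical
  ext v; simp [vertexExponent_apply]

lemma prod_X_eq_monomial (G : Finset W) :
    ∏ j ∈ G, (X j : MvPolynomial W K) = monomial (vertexExponent G) 1 := by
  classical
  have : vertexExponent G = ∑ j ∈ G, Finsupp.single j 1 := by
    ext v; simp [vertexExponent_apply, Finsupp.single_apply]
  rw [this, monomial_sum_one]
  rfl

variable (K) in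
/-- The ideal generated by the squarefree monomials `x_G`, `G ∈ 𝓖`. -/
def squarefreeIdeal (𝓖 : Set (Finset W)) : Ideal (MvPolynomial W K) :=
  Ideal.span ((fun G => ∏ j ∈ G, X j) '' 𝓖)

lemma squarefreeIdeal_eq_span_monomial (𝓖 : Set (Finset W)) :
    squarefreeIdeal K 𝓖 =
      Ideal.span ((fun u => monomial u (1 : K)) '' (vertexExponent '' 𝓖)) := by
  simp only [squarefreeIdeal, Set.image_image, prod_X_eq_monomial]

lemma mem_squarefreeIdeal {𝓖 : Set (Finset W)} {f : MvPolynomial W K} :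
    f ∈ squarefreeIdeal K 𝓖 ↔ ∀ u ∈ f.support, ∃ G ∈ 𝓖, G ⊆ u.support := by
  simp [squarefreeIdeal_eq_span_monomial, mem_ideal_span_monomial_image, vertexExponent_le_iff]

lemma monomial_mem_squarefreeIdeal {𝓖 : Set (Finset W)} {u : W →₀ ℕ} {a : K} (ha : a ≠ 0) :
    monomial u a ∈ squarefreeIdeal K 𝓖 ↔ ∃ G ∈ 𝓖, G ⊆ u.support := by
  classical
  simp [mem_squarefreeIdeal, support_monomial, ha]

lemma isSquarefreeMonomialIdeal_squarefreeIdeal (𝓖 : Set (Finset W)) :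
    IsSquarefreeMonomialIdeal (squarefreeIdeal K 𝓖) := by
  classical
  refine ⟨vertexExponent '' 𝓖, ?_, squarefreeIdeal_eq_span_monomial 𝓖⟩
  rintro _ ⟨G, -, rfl⟩ j
  rw [vertexExponent_apply]
  split_ifs <;> simp

/-- Injectivity on each generator rules out squares in the image. -/
lemma map_rename_squarefreeIdeal [DecidableEq W'] (σ : W → W') {𝓖 : Set (Finset W)}
    (h : ∀ G ∈ 𝓖, Set.InjOn σ G) :
    (squarefreeIdeal K 𝓖).map (rename (R := K) σ) =
      squarefreeIdeal K ((Finset.image σ) '' 𝓖) := by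
  rw [squarefreeIdeal, Ideal.map_span, squarefreeIdeal, Set.image_image, Set.image_image]
  congr 1
  refine Set.image_congr fun G hG => ?_
  rw [Finset.prod_image (h G hG), map_prod]
  simp

lemma comap_rename_equiv (e : W ≃ W') (J : Ideal (MvPolynomial W' K)) :
    J.comap (rename (R := K) e) = J.map (rename (R := K) e.symm) := by
  have := Ideal.map_symm (I := J) (renameEquiv K e).toRingEquiv
  exact this.symm

/-- A concrete form of reduction modulo the prime generated by the variables outside `F`: monomials
supported in `F` are untouched, all others vanish. -/
lemma coeff_killOutside [DecidableEq W] (F : Finset W) (f : MvPolynomial W K) {u : W →₀ ℕ}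
    (hu : u.support ⊆ F) :
    coeff u (aeval (fun v => if v ∈ F then X v else 0 : W → MvPolynomial W K) f) =
      coeff u f := by
  induction f using MvPolynomial.induction_on' with
  | add p q hp hq => rw [map_add, coeff_add, coeff_add, hp, hq]
  | monomial w a =>
    rw [aeval_monomial]
    by_cases hw : w.support ⊆ F
    · rw [Finsupp.prod_congr (g2 := fun v n => (X v : MvPolynomial W K) ^ n)]
      · rw [monomial_eq]; rfl
      · intro v hv
        rw [if_pos (hw hv)]
    · obtain ⟨v, hv, hvF⟩ := Finset.not_subset.mp hw
      rw [Finsupp.prod, Finset.prod_eq_zero hv]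
      · have : w ≠ u := by rintro rfl; exact hw hu
        simp [coeff_monomial, this]
      · rw [if_neg hvF, zero_pow (by simpa using hv)]

/-- If no minimal prime of a squarefree monomial ideal contains both `x_a` and `x_b`, then
`x_a - x_b` is a non-zero-divisor modulo the ideal. -/
lemma mem_squarefreeIdeal_of_X_sub_X_mul [DecidableEq W] {𝓖 : Set (Finset W)} {a b : W}
    (hab : a ≠ b)
    (h : ∀ G ∈ 𝓖, ∀ G' ∈ 𝓖, a ∈ G → b ∈ G' → ∃ H ∈ 𝓖, H ⊆ G.erase a ∪ G'.erase b)
    {f : MvPolynomial W K} (hf : (X a - X b) * f ∈ squarefreeIdeal K 𝓖) :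
    f ∈ squarefreeIdeal K 𝓖 := by
  rw [mem_squarefreeIdeal]
  intro u hu
  by_contra! hcon
  -- If `F` contained no generator, `π` would kill the ideal. It does not kill `X a - X b` because
  -- `F` meets `{a, b}`, and its target is a domain, so it would kill `f`, which has the monomial
  -- `u` supported in `F`.
  have key : ∀ F : Finset W, u.support ⊆ F → (a ∈ F ∨ b ∈ F) → ∃ G ∈ 𝓖, G ⊆ F := by
    intro F hF hcF
    by_contra! hG
    set π : MvPolynomial W K →ₐ[K] MvPolynomial W K :=
      aeval (fun v => if v ∈ F then X v else 0)
    have hπ : squarefreeIdeal K 𝓖 ≤ RingHom.ker π := by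
      rw [squarefreeIdeal, Ideal.span_le]
      rintro _ ⟨G, hG', rfl⟩
      obtain ⟨v, hv, hvF⟩ := Finset.not_subset.mp (hG G hG')
      simp only [SetLike.mem_coe, RingHom.mem_ker, map_prod]
      exact Finset.prod_eq_zero hv (by simp [π, hvF])
    have h0 : π ((X a - X b) * f) = 0 := hπ hf
    rw [map_mul, mul_eq_zero] at h0
    rcases h0 with h0 | h0
    · have hX : (X a : MvPolynomial W K) - X b ≠ 0 := by
        rw [sub_ne_zero]; exact fun hh => hab (X_injective hh)
      simp only [π, map_sub, aeval_X] at h0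
      by_cases ha : a ∈ F <;> by_cases hb : b ∈ F <;> simp [ha, hb] at h0
      · exact hX h0
      · tauto
    · have := coeff_killOutside F f hF
      change coeff u (π f) = _ at this
      rw [h0] at this
      exact (mem_support_iff.mp hu) (by simpa using this.symm)
  obtain ⟨G, hG, hGF⟩ := key (insert a u.support) (Finset.subset_insert _ _) (by simp)
  obtain ⟨G', hG', hGF'⟩ := key (insert b u.support) (Finset.subset_insert _ _) (by simp)
  have ha : a ∈ G := by
    by_contra ha
    exact hcon G hG ((Finset.subset_insert_iff_of_notMem ha).mp hGF)
  have hb : b ∈ G' := by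
    by_contra ha
    exact hcon G' hG' ((Finset.subset_insert_iff_of_notMem ha).mp hGF')
  obtain ⟨H, hH, hHs⟩ := h G hG G' hG' ha hb
  refine hcon H hH (hHs.trans (Finset.union_subset ?_ ?_))
  · rwa [← Finset.subset_insert_iff]
  · rwa [← Finset.subset_insert_iff]

/-- The minimal non-faces of a simplicial complex. -/
def minimalNonfaces (Δ : SimplicialComplexOn W) : Set (Finset W) := {N | Minimal (· ∉ Δ) N}

lemma exists_minimalNonface_subset {Δ : SimplicialComplexOn W} {N : Finset W} (h : N ∉ Δ) :
    ∃ G ∈ minimalNonfaces Δ, G ⊆ N := by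
  obtain ⟨G, hG, hm⟩ := exists_minimal_le_of_wellFoundedLT (fun N : Finset W => N ∉ Δ) N h
  exact ⟨G, hm, hG⟩

lemma notMem_iff_exists_minimalNonface {Δ : SimplicialComplexOn W} {N : Finset W} :
    N ∉ Δ ↔ ∃ G ∈ minimalNonfaces Δ, G ⊆ N :=
  ⟨exists_minimalNonface_subset, fun ⟨_, hG, hGN⟩ hN => hG.1 (Δ.lower hGN hN)⟩

lemma eq_of_minimalNonfaces_subset {Δ : SimplicialComplexOn W} {G H : Finset W}
    (hG : G ∈ minimalNonfaces Δ) (hH : H ∈ minimalNonfaces Δ) (h : G ⊆ H) : G = H :=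
  Finset.Subset.antisymm h (hH.2 hG.1 h)

lemma stanleyReisnerIdeal_eq_of_forall {Δ : SimplicialComplexOn W} {𝓖 : Set (Finset W)}
    (h : ∀ N, N ∉ Δ ↔ ∃ G ∈ 𝓖, G ⊆ N) :
    stanleyReisnerIdeal K Δ = squarefreeIdeal K 𝓖 := by
  have h1 : stanleyReisnerIdeal K Δ = squarefreeIdeal K {N | N ∉ Δ} := by
    rw [stanleyReisnerIdeal, squarefreeIdeal]
    congr 1
    ext f; simp [eq_comm]
  rw [h1]
  ext f
  rw [mem_squarefreeIdeal, mem_squarefreeIdeal]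
  refine forall₂_congr fun u _ => ⟨?_, ?_⟩
  · rintro ⟨N, hN, hNu⟩
    obtain ⟨G, hG, hGN⟩ := (h N).mp hN
    exact ⟨G, hG, hGN.trans hNu⟩
  · rintro ⟨G, hG, hGu⟩
    exact ⟨G, (h G).mpr ⟨G, hG, subset_rfl⟩, hGu⟩

lemma stanleyReisnerIdeal_eq_squarefreeIdeal (Δ : SimplicialComplexOn W) :
    stanleyReisnerIdeal K Δ = squarefreeIdeal K (minimalNonfaces Δ) :=
  stanleyReisnerIdeal_eq_of_forall fun _ => notMem_iff_exists_minimalNonface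

lemma isMinimalGenerator_vertexExponent {𝓖 : Set (Finset W)}
    (hanti : ∀ G ∈ 𝓖, ∀ H ∈ 𝓖, G ⊆ H → G = H) {G : Finset W} (hG : G ∈ 𝓖) :
    IsMinimalGenerator (squarefreeIdeal K 𝓖) (vertexExponent G) := by
  refine ⟨?_, fun w hw hmem => ?_⟩
  · rw [monomial_mem_squarefreeIdeal one_ne_zero, support_vertexExponent]
    exact ⟨G, hG, subset_rfl⟩
  · rw [monomial_mem_squarefreeIdeal one_ne_zero] at hmem
    obtain ⟨H, hH, hHw⟩ := hmem
    have hwG : w.support ⊆ G := by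
      rw [← support_vertexExponent G]
      exact Finsupp.support_mono hw
    obtain rfl := hanti H hH G hG (hHw.trans hwG)
    exact le_antisymm hw (vertexExponent_le_iff.mpr hHw)

end SquarefreeIdeal

/-! ### Graded pieces of `Hom(I, S/I)` and `T¹`. -/

section CotangentDegree

variable {K : Type*} [Field K] {W : Type*}

lemma hom_squarefreeIdeal_ext {𝓖 : Set (Finset W)} {M : Type*} [AddCommGroup M]
    [Module (MvPolynomial W K) M] {φ ψ : squarefreeIdeal K 𝓖 →ₗ[MvPolynomial W K] M}
    (h : ∀ G ∈ 𝓖, ∀ hm : monomial (vertexExponent G) (1 : K) ∈ squarefreeIdeal K 𝓖,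
      φ ⟨_, hm⟩ = ψ ⟨_, hm⟩) : φ = ψ := by
  ext ⟨f, hf⟩
  have : f ∈ Submodule.span (MvPolynomial W K) ((fun G => ∏ j ∈ G, X j) '' 𝓖) := hf
  induction this using Submodule.span_induction with
  | mem f hfm =>
    obtain ⟨G, hG, rfl⟩ := hfm
    have e := prod_X_eq_monomial (K := K) G
    simp only [e] at hf ⊢
    exact h G hG hf
  | zero => exact (map_zero φ).trans (map_zero ψ).symm
  | add f g hf' hg' h1 h2 =>
    have := congrArg₂ (· + ·) (h1 hf') (h2 hg')
    simp only [← map_add] at this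
    exact this
  | smul a f hf' h1 =>
    have := congrArg (a • ·) (h1 hf')
    simp only [← map_smul] at this
    exact this

lemma mk_monomial_eq_zero {𝓖 : Set (Finset W)} {u : W →₀ ℕ} {G : Finset W} (hG : G ∈ 𝓖)
    (h : G ⊆ u.support) (a : K) :
    Ideal.Quotient.mk (squarefreeIdeal K 𝓖) (monomial u a) = 0 := by
  rw [Ideal.Quotient.eq_zero_iff_mem]
  by_cases ha : a = 0
  · simp [ha]
  · exact (monomial_mem_squarefreeIdeal ha).mpr ⟨G, hG, h⟩

lemma exists_smul_of_mem_quotientDegree {I : Ideal (MvPolynomial W K)} {c : W → ℤ}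
    {u : W →₀ ℕ} (hu : ∀ j, (u j : ℤ) = c j) {q : MvPolynomial W K ⧸ I}
    (hq : q ∈ quotientDegree I c) : ∃ a : K, q = a • Ideal.Quotient.mk I (monomial u 1) := by
  have hle : quotientDegree I c ≤ Submodule.span K {Ideal.Quotient.mk I (monomial u 1)} := by
    refine Submodule.span_mono ?_
    rintro _ ⟨u', hu', rfl⟩
    have : u' = u := by
      ext j
      have := (hu' j).trans (hu j).symm
      exact_mod_cast this
    rw [this]; rfl
  obtain ⟨a, ha⟩ := Submodule.mem_span_singleton.mp (hle hq)
  exact ⟨a, ha.symm⟩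

lemma quotientDegree_eq_bot {I : Ideal (MvPolynomial W K)} {c : W → ℤ} {j : W} (h : c j < 0) :
    quotientDegree I c = ⊥ := by
  rw [quotientDegree, Submodule.span_eq_bot]
  rintro _ ⟨u, hu, -⟩
  have := hu j
  omega

lemma smul_mk_monomial_injective {𝓖 : Set (Finset W)} {u : W →₀ ℕ}
    (hu : ∀ H ∈ 𝓖, ¬ H ⊆ u.support) {a b : K}
    (h : a • Ideal.Quotient.mk (squarefreeIdeal K 𝓖) (monomial u 1) =
      b • Ideal.Quotient.mk (squarefreeIdeal K 𝓖) (monomial u 1)) : a = b := by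
  by_contra hab
  have h1 : Ideal.Quotient.mk (squarefreeIdeal K 𝓖) (monomial u (a - b)) = 0 := by
    have h2 : (monomial u (a - b) : MvPolynomial W K) = a • monomial u 1 - b • monomial u 1 := by
      simp [smul_monomial]
    rw [h2, map_sub, sub_eq_zero]
    exact h
  rw [Ideal.Quotient.eq_zero_iff_mem, monomial_mem_squarefreeIdeal (sub_ne_zero.mpr hab)] at h1
  obtain ⟨H, hH, hHu⟩ := h1
  exact hu H hH hHu

/-- In a non-positive degree other than `0` and `-e_w`, and more generally when no generator
stays non-negative, there are no homomorphisms. -/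
lemma T1Degree_eq_bot_of_forall {𝓖 : Set (Finset W)} {c : W → ℤ}
    (h : ∀ G ∈ 𝓖, c = 0 ∨ ∃ j, (vertexExponent G j : ℤ) + c j < 0) :
    T1Degree (squarefreeIdeal K 𝓖) c = ⊥ := by
  have : homDegree (squarefreeIdeal K 𝓖) c = ⊥ := by
    rw [eq_bot_iff]
    intro φ hφ
    rw [Submodule.mem_bot]
    refine hom_squarefreeIdeal_ext fun G hG hm => ?_
    have h1 := hφ _ hm
    rw [LinearMap.zero_apply]
    -- In degree `0` the image of `x_G` is a multiple of `x_G`, which is zero in the quotient;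
    -- otherwise the target component is zero.
    rcases h G hG with rfl | ⟨j, hj⟩
    · obtain ⟨a, ha⟩ := exists_smul_of_mem_quotientDegree (u := vertexExponent G) (by simp) h1
      rw [ha, mk_monomial_eq_zero hG (by rw [support_vertexExponent]), smul_zero]
    · rwa [quotientDegree_eq_bot (j := j) hj, Submodule.mem_bot] at h1
  rw [T1Degree, this, Submodule.map_bot]

/-! ### The graph of generators through `w` computes `T¹` in degree `-e_w`. -/

variable [DecidableEq W]

/-- Two members of `𝓖` through `w` are adjacent if their union without `w` contains no member
of `𝓖`. -/
def LinkAdj (𝓖 : Set (Finset W)) (w : W) (G G' : {G : Finset W // G ∈ 𝓖 ∧ w ∈ G}) : Prop :=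
  ∀ H ∈ 𝓖, ¬ H ⊆ (G.1 ∪ G'.1).erase w

/-- The connected components of the graph given by `LinkAdj`. -/
abbrev LinkComponents (𝓖 : Set (Finset W)) (w : W) : Type _ := Quot (LinkAdj 𝓖 w)

/-- The component of `G`. -/
def linkComponent {𝓖 : Set (Finset W)} {w : W} (G : Finset W) (hG : G ∈ 𝓖) (hw : w ∈ G) :
    LinkComponents 𝓖 w := Quot.mk _ ⟨G, hG, hw⟩

/-- The scalar by which the homomorphism attached to a function on components acts on `x^u`. -/
def linkScalar {𝓖 : Set (Finset W)} {w : W} (u : W →₀ ℕ) :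
    (LinkComponents 𝓖 w → K) →ₗ[K] K := by
  classical
  -- The choice of `G` matters only when `u.support.erase w` contains a generator, and then `x^(u -
  -- e_w)` is zero modulo the ideal anyway.
  exact if h : ∃ G, (G ∈ 𝓖 ∧ w ∈ G) ∧ G ⊆ u.support then
    LinearMap.proj (linkComponent h.choose h.choose_spec.1.1 h.choose_spec.1.2) else 0

/-- Under `hu`, any two generators through `w` inside the support of `u` are adjacent, so the chosen
one has the same component as `G`. -/
lemma linkScalar_of_adj {𝓖 : Set (Finset W)} {w : W} {u : W →₀ ℕ} {G : Finset W} (hG : G ∈ 𝓖)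
    (hw : w ∈ G) (hGu : G ⊆ u.support) (hu : ∀ H ∈ 𝓖, ¬ H ⊆ u.support.erase w)
    (f : LinkComponents 𝓖 w → K) : linkScalar u f = f (linkComponent G hG hw) := by
  have h : ∃ G, (G ∈ 𝓖 ∧ w ∈ G) ∧ G ⊆ u.support := ⟨G, ⟨hG, hw⟩, hGu⟩
  rw [linkScalar, dif_pos h, LinearMap.proj_apply]
  congr 1
  refine Quot.sound fun H hH hHs => hu H hH (hHs.trans (Finset.erase_subset_erase _ ?_))
  exact Finset.union_subset h.choose_spec.2 hGu

lemma linkScalar_of_forall_not {𝓖 : Set (Finset W)} {w : W} {u : W →₀ ℕ}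
    (hu : ∀ G ∈ 𝓖, w ∈ G → ¬ G ⊆ u.support) (f : LinkComponents 𝓖 w → K) :
    linkScalar u f = 0 := by
  have h : ¬ ∃ G, (G ∈ 𝓖 ∧ w ∈ G) ∧ G ⊆ u.support :=
    fun ⟨G, ⟨hG, hw⟩, hGu⟩ => hu G hG hw hGu
  rw [linkScalar, dif_neg h, LinearMap.zero_apply]

variable (K) in
/-- The `K`-linear map `x^u ↦ λ_u x^(u - e_w)` on the polynomial ring. -/
def linkMap (𝓖 : Set (Finset W)) (w : W) (f : LinkComponents 𝓖 w → K) :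
    MvPolynomial W K →ₗ[K] MvPolynomial W K ⧸ squarefreeIdeal K 𝓖 :=
  (basisMonomials W K).constr K fun u =>
    linkScalar u f • Ideal.Quotient.mk _ (monomial (u - Finsupp.single w 1) 1)

lemma linkMap_monomial (𝓖 : Set (Finset W)) (w : W) (f : LinkComponents 𝓖 w → K)
    (u : W →₀ ℕ) : linkMap K 𝓖 w f (monomial u 1) =
      linkScalar u f • Ideal.Quotient.mk _ (monomial (u - Finsupp.single w 1) 1) := by
  have := (basisMonomials W K).constr_basis K (fun u =>
    linkScalar u f • Ideal.Quotient.mk (squarefreeIdeal K 𝓖)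
      (monomial (u - Finsupp.single w 1) 1)) u
  rwa [coe_basisMonomials] at this

lemma support_tsub_single (u : W →₀ ℕ) (w : W) :
    u.support.erase w ⊆ (u - Finsupp.single w 1).support := by
  intro v hv
  rw [Finset.mem_erase] at hv
  simp only [Finsupp.mem_support_iff, Finsupp.tsub_apply] at hv ⊢
  rw [Finsupp.single_eq_of_ne hv.1]
  simpa using hv.2

/-- Either the target monomial lies in the ideal and both sides vanish, or every generator dividing
the product passes through `w` and all of them lie in one component, so the two scalars agree. The
hypothesis `hu` is essential: the map is `S`-linear only on the ideal. -/
lemma linkMap_monomial_mul {𝓖 : Set (Finset W)} {w : W} (f : LinkComponents 𝓖 w → K)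
    (a u : W →₀ ℕ) (hu : ∃ G ∈ 𝓖, G ⊆ u.support) :
    linkMap K 𝓖 w f (monomial a 1 * monomial u 1) =
      Ideal.Quotient.mk _ (monomial a 1) * linkMap K 𝓖 w f (monomial u 1) := by
  have hsub : u.support ⊆ (a + u).support := Finsupp.support_mono le_add_self
  rw [monomial_mul, one_mul, linkMap_monomial, linkMap_monomial]
  by_cases h : ∃ H ∈ 𝓖, H ⊆ (a + u).support.erase w
  · obtain ⟨H, hH, hHs⟩ := h
    rw [mk_monomial_eq_zero hH (hHs.trans (support_tsub_single _ _)), smul_zero,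
      mul_smul_comm, ← map_mul, monomial_mul]
    rw [mk_monomial_eq_zero hH, smul_zero]
    -- Subtraction is truncated: if `w` is absent from `u`, only the inequality `(a + u) - e_w ≤ a +
    -- (u - e_w)` is available.
    refine (hHs.trans (support_tsub_single _ _)).trans (Finsupp.support_mono ?_)
    intro v
    simp only [Finsupp.tsub_apply, Finsupp.add_apply]
    omega
  · push Not at h
    obtain ⟨G, hG, hGu⟩ := hu
    have hw : w ∈ G := by
      by_contra hw
      exact h G hG (Finset.subset_erase.mpr ⟨hGu.trans hsub, hw⟩)
    rw [linkScalar_of_adj hG hw (hGu.trans hsub) h, linkScalar_of_adj hG hw hGu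
      fun H hH hHs => h H hH (hHs.trans (Finset.erase_subset_erase _ hsub)),
      mul_smul_comm, ← map_mul, monomial_mul, one_mul, add_tsub_assoc_of_le]
    rw [Finsupp.single_le_iff]
    have := hGu hw
    simp at this; omega

lemma linkMap_mul {𝓖 : Set (Finset W)} {w : W} (f : LinkComponents 𝓖 w → K)
    (s g : MvPolynomial W K) (hg : g ∈ squarefreeIdeal K 𝓖) :
    linkMap K 𝓖 w f (s * g) = Ideal.Quotient.mk _ s * linkMap K 𝓖 w f g := by
  rw [mem_squarefreeIdeal] at hg
  induction s using MvPolynomial.induction_on' with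
  | add p q hp hq => rw [add_mul, map_add, hp, hq, map_add, add_mul]
  | monomial a c =>
    rw [g.as_sum, Finset.mul_sum, map_sum, map_sum, Finset.mul_sum]
    refine Finset.sum_congr rfl fun u hu => ?_
    have h1 : ∀ (v : W →₀ ℕ) (d : K), monomial v d = d • monomial v (1 : K) := by
      intro v d; simp [smul_monomial]
    have h2 := linkMap_monomial_mul f a u (hg u hu)
    have h3 : monomial a c * monomial u (coeff u g) =
        (c * coeff u g) • (monomial a (1 : K) * monomial u (1 : K)) := by
      rw [h1 a c, h1 u (coeff u g), smul_mul_smul_comm]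
    have h4 : Ideal.Quotient.mk (squarefreeIdeal K 𝓖) (monomial a c) =
        c • Ideal.Quotient.mk (squarefreeIdeal K 𝓖) (monomial a (1 : K)) := by
      rw [h1 a c]; rfl
    rw [h3, h4, h1 u (coeff u g), map_smul, map_smul, h2, smul_mul_smul_comm]

variable (K) in
/-- The homomorphism `x_G ↦ f(G) x_(G \ w)` attached to a function `f` on components. -/
def linkHom (𝓖 : Set (Finset W)) (w : W) :
    (LinkComponents 𝓖 w → K) →ₗ[K]
      (squarefreeIdeal K 𝓖 →ₗ[MvPolynomial W K] MvPolynomial W K ⧸ squarefreeIdeal K 𝓖) where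
  toFun f :=
    { toFun := fun g => linkMap K 𝓖 w f g
      map_add' := fun g h => by simp
      map_smul' := fun s g => linkMap_mul f s g g.2 }
  map_add' f f' := by
    refine hom_squarefreeIdeal_ext fun G hG hm => ?_
    change linkMap K 𝓖 w (f + f') _ = linkMap K 𝓖 w f _ + linkMap K 𝓖 w f' _
    simp only [linkMap_monomial, map_add, add_smul]
  map_smul' a f := by
    refine hom_squarefreeIdeal_ext fun G hG hm => ?_
    change linkMap K 𝓖 w (a • f) _ = a • linkMap K 𝓖 w f _
    simp only [linkMap_monomial, map_smul, smul_assoc]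

lemma linkHom_apply (𝓖 : Set (Finset W)) (w : W) (f : LinkComponents 𝓖 w → K)
    (g : squarefreeIdeal K 𝓖) : linkHom K 𝓖 w f g = linkMap K 𝓖 w f g := rfl

lemma linkHom_mem_homDegree (𝓖 : Set (Finset W)) (w : W) (f : LinkComponents 𝓖 w → K) :
    linkHom K 𝓖 w f ∈ homDegree (squarefreeIdeal K 𝓖) (-Pi.single w 1) := by
  intro u hu
  rw [linkHom_apply, linkMap_monomial]
  by_cases h0 : u w = 0
  · rw [linkScalar_of_forall_not, zero_smul]
    · exact Submodule.zero_mem _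
    · intro G _ hwG hGu
      simpa [h0] using hGu hwG
  · refine Submodule.smul_mem _ _ (Submodule.subset_span ⟨_, fun j => ?_, rfl⟩)
    simp only [Finsupp.tsub_apply, Pi.neg_apply, Pi.single_apply, Finsupp.single_apply]
    by_cases hj : j = w
    · subst hj; simp; omega
    · simp [hj, Ne.symm hj]

lemma coe_tsub_single_of_mem {G : Finset W} {w : W} (hw : w ∈ G) (j : W) :
    (((vertexExponent G - Finsupp.single w 1 : W →₀ ℕ) j : ℕ) : ℤ) =
      (vertexExponent G j : ℤ) + (-Pi.single w 1 : W → ℤ) j := by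
  have := vertexExponent_of_mem hw
  simp only [Finsupp.tsub_apply, Pi.neg_apply, Pi.single_apply, Finsupp.single_apply]
  by_cases hj : j = w
  · subst hj; simp [this]
  · simp [hj, Ne.symm hj]

lemma vertexExponent_tsub_single (G : Finset W) (w : W) :
    vertexExponent G - Finsupp.single w 1 = vertexExponent (G.erase w) := by
  ext j
  simp only [Finsupp.tsub_apply, vertexExponent_apply, Finsupp.single_apply, Finset.mem_erase]
  by_cases hj : j = w
  · subst hj; simp; split_ifs <;> simp
  · simp [hj, Ne.symm hj]

lemma vertexExponent_add_sdiff (G G' : Finset W) :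
    vertexExponent (G' \ G) + vertexExponent G = vertexExponent (G ∪ G') := by
  ext j
  simp only [Finsupp.add_apply, vertexExponent_apply, Finset.mem_sdiff, Finset.mem_union]
  by_cases h : j ∈ G <;> by_cases h' : j ∈ G' <;> simp [h, h']

/-- A homomorphism of degree `-e_w` is given by scalars that agree on adjacent generators. -/
lemma exists_linkHom_eq {𝓖 : Set (Finset W)} (hanti : ∀ G ∈ 𝓖, ∀ H ∈ 𝓖, G ⊆ H → G = H)
    {w : W} {φ : squarefreeIdeal K 𝓖 →ₗ[MvPolynomial W K] MvPolynomial W K ⧸ squarefreeIdeal K 𝓖}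
    (hφ : φ ∈ homDegree (squarefreeIdeal K 𝓖) (-Pi.single w 1)) :
    ∃ f, linkHom K 𝓖 w f = φ := by
  have hmem : ∀ G ∈ 𝓖, monomial (vertexExponent G) (1 : K) ∈ squarefreeIdeal K 𝓖 :=
    fun G hG => (monomial_mem_squarefreeIdeal one_ne_zero).mpr
      ⟨G, hG, by rw [support_vertexExponent]⟩
  have hl : ∀ G : {G : Finset W // G ∈ 𝓖 ∧ w ∈ G}, ∃ a : K,
      φ ⟨_, hmem G.1 G.2.1⟩ =
        a • Ideal.Quotient.mk _ (monomial (vertexExponent (G.1.erase w)) 1) := by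
    intro G
    rw [← vertexExponent_tsub_single]
    exact exists_smul_of_mem_quotientDegree (coe_tsub_single_of_mem G.2.2) (hφ _ _)
  choose l hl using hl
  -- The left side is symmetric in `G` and `G'`; exchanging them compares `l G` with `l G'` whenever
  -- the monomial on the right survives.
  have hunion : ∀ G G' : {G : Finset W // G ∈ 𝓖 ∧ w ∈ G},
      ∀ hm : monomial (vertexExponent (G.1 ∪ G'.1)) (1 : K) ∈ squarefreeIdeal K 𝓖,
      φ ⟨_, hm⟩ =
        l G • Ideal.Quotient.mk _ (monomial (vertexExponent ((G.1 ∪ G'.1).erase w)) 1) := by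
    intro G G' hm
    have e1 : (⟨_, hm⟩ : squarefreeIdeal K 𝓖) =
        (monomial (vertexExponent (G'.1 \ G.1)) (1 : K)) • ⟨_, hmem G.1 G.2.1⟩ := by
      ext1
      simp [monomial_mul, vertexExponent_add_sdiff]
    have hsmul : ∀ p q : MvPolynomial W K, p • Ideal.Quotient.mk (squarefreeIdeal K 𝓖) q =
        Ideal.Quotient.mk _ (p * q) := fun _ _ => rfl
    have e2 : (G'.1 \ G.1) = (G'.1.erase w) \ (G.1.erase w) := by
      ext v
      have := G.2.2
      by_cases hv : v = w
      · subst hv; simp [this]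
      · simp [hv]
    rw [e1, map_smul, hl, smul_comm (monomial _ (1 : K)), hsmul, monomial_mul,
      one_mul, e2, vertexExponent_add_sdiff, ← Finset.erase_union_distrib]
  have hadj : ∀ G G', LinkAdj 𝓖 w G G' → l G = l G' := by
    intro G G' h
    have hm : monomial (vertexExponent (G.1 ∪ G'.1)) (1 : K) ∈ squarefreeIdeal K 𝓖 := by
      rw [monomial_mem_squarefreeIdeal one_ne_zero, support_vertexExponent]
      exact ⟨G, G.2.1, Finset.subset_union_left⟩
    have h1 := hunion G G' hm
    have hm' := hm
    rw [Finset.union_comm] at hm'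
    have h2 := hunion G' G hm'
    simp only [Finset.union_comm G'.1 G.1] at h2
    rw [h1] at h2
    exact smul_mk_monomial_injective (by rwa [support_vertexExponent]) h2
  refine ⟨Quot.lift l hadj, hom_squarefreeIdeal_ext fun G hG hm => ?_⟩
  rw [linkHom_apply, linkMap_monomial]
  by_cases hw : w ∈ G
  · rw [hl ⟨G, hG, hw⟩, vertexExponent_tsub_single,
      linkScalar_of_adj hG hw (by rw [support_vertexExponent])]
    · rfl
    · intro H hH hHs
      rw [support_vertexExponent] at hHs
      obtain rfl := hanti H hH G hG (hHs.trans (Finset.erase_subset _ _))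
      exact Finset.notMem_erase w H (hHs hw)
  · rw [linkScalar_of_forall_not, zero_smul]
    · have := hφ _ hm
      rw [quotientDegree_eq_bot (j := w), Submodule.mem_bot] at this
      · exact this.symm
      · simp [vertexExponent_of_notMem hw]
    · intro H _ hwH hHs
      rw [support_vertexExponent] at hHs
      exact hw (hHs hwH)

/-- The derivation `a ∂/∂x_w` induces it. -/
lemma linkHom_mem_range_deltaStar_of_const {𝓖 : Set (Finset W)}
    (hanti : ∀ G ∈ 𝓖, ∀ H ∈ 𝓖, G ⊆ H → G = H) {w : W} {f : LinkComponents 𝓖 w → K} {a : K}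
    (hf : ∀ q, f q = a) : linkHom K 𝓖 w f ∈ LinearMap.range (deltaStar (squarefreeIdeal K 𝓖)) := by
  refine ⟨(C a : MvPolynomial W K) • pderiv w, hom_squarefreeIdeal_ext fun G hG hm => ?_⟩
  rw [linkHom_apply, linkMap_monomial]
  change Ideal.Quotient.mk _ (C a * pderiv w (monomial (vertexExponent G) 1)) = _
  rw [pderiv_monomial]
  by_cases hw : w ∈ G
  · rw [linkScalar_of_adj hG hw (by rw [support_vertexExponent]), hf, vertexExponent_of_mem hw]
    · rw [← smul_eq_C_mul, Nat.cast_one, one_mul]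
      rfl
    · intro H hH hHs
      rw [support_vertexExponent] at hHs
      obtain rfl := hanti H hH G hG (hHs.trans (Finset.erase_subset _ _))
      exact Finset.notMem_erase w H (hHs hw)
  · rw [linkScalar_of_forall_not, vertexExponent_of_notMem hw]
    · simp
    · intro H _ hwH hHs
      rw [support_vertexExponent] at hHs
      exact hw (hHs hwH)

/-- Write `x_G = x_w x_(G \ w)` and compare coefficients of `x_(G \ w)`. The Leibniz term divisible
by `x_w` contributes nothing, and the other contributes the constant term of `D(x_w)`, which does
not depend on `G`. -/
lemma const_of_linkHom_mem_range_deltaStar {𝓖 : Set (Finset W)}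
    (hanti : ∀ G ∈ 𝓖, ∀ H ∈ 𝓖, G ⊆ H → G = H) {w : W} {f : LinkComponents 𝓖 w → K}
    (h : linkHom K 𝓖 w f ∈ LinearMap.range (deltaStar (squarefreeIdeal K 𝓖))) :
    ∃ a, ∀ q, f q = a := by
  obtain ⟨D, hD⟩ := h
  refine ⟨coeff 0 (D (X w)), ?_⟩
  rintro ⟨G, hG, hw⟩
  have herase : ∀ H ∈ 𝓖, ¬ H ⊆ G.erase w := by
    intro H hH hHs
    obtain rfl := hanti H hH G hG (hHs.trans (Finset.erase_subset _ _))
    exact Finset.notMem_erase w H (hHs hw)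
  have hm : monomial (vertexExponent G) (1 : K) ∈ squarefreeIdeal K 𝓖 :=
    (monomial_mem_squarefreeIdeal one_ne_zero).mpr ⟨G, hG, by rw [support_vertexExponent]⟩
  have h1 := LinearMap.congr_fun hD ⟨_, hm⟩
  rw [linkHom_apply, linkMap_monomial, vertexExponent_tsub_single,
    linkScalar_of_adj hG hw (by rw [support_vertexExponent])
      (by rwa [support_vertexExponent])] at h1
  change Ideal.Quotient.mk _ (D (monomial (vertexExponent G) 1)) =
    Ideal.Quotient.mk _ (f (linkComponent G hG hw) • monomial _ 1) at h1
  rw [Ideal.Quotient.eq, mem_squarefreeIdeal] at h1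
  have h2 : coeff (vertexExponent (G.erase w)) (D (monomial (vertexExponent G) 1) -
      f (linkComponent G hG hw) • monomial (vertexExponent (G.erase w)) 1) = 0 := by
    by_contra hne
    obtain ⟨H, hH, hHs⟩ := h1 _ (mem_support_iff.mpr hne)
    rw [support_vertexExponent] at hHs
    exact herase H hH hHs
  have h3 : (monomial (vertexExponent G) 1 : MvPolynomial W K) =
      X w * monomial (vertexExponent (G.erase w)) 1 := by
    rw [← prod_X_eq_monomial, ← prod_X_eq_monomial, Finset.mul_prod_erase _ _ hw]
  have h4 : coeff (vertexExponent (G.erase w)) (monomial (vertexExponent (G.erase w)) 1 * D (X w))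
      = coeff 0 (D (X w)) := by
    have := coeff_monomial_mul 0 (vertexExponent (G.erase w)) 1 (D (X w))
    simpa using this
  rw [h3, D.leibniz, coeff_sub, coeff_add, smul_eq_mul, smul_eq_mul, h4, coeff_X_mul',
    if_neg (by simp [support_vertexExponent]), zero_add, coeff_smul, coeff_monomial,
    if_pos rfl, smul_eq_mul, mul_one, sub_eq_zero] at h2
  exact h2.symm

/-- With the two preceding lemmas this identifies `T¹` in degree `-e_w` with functions on components
modulo constants. -/
lemma T1Degree_eq_range (𝓖 : Set (Finset W)) (hanti : ∀ G ∈ 𝓖, ∀ H ∈ 𝓖, G ⊆ H → G = H) (w : W) :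
    T1Degree (squarefreeIdeal K 𝓖) (-Pi.single w 1) =
      LinearMap.range (((LinearMap.range (deltaStar (squarefreeIdeal K 𝓖))).mkQ.restrictScalars
        K) ∘ₗ linkHom K 𝓖 w) := by
  rw [LinearMap.range_comp, T1Degree]
  congr 1
  ext φ
  exact ⟨exists_linkHom_eq hanti, fun ⟨f, hf⟩ => hf ▸ linkHom_mem_homDegree 𝓖 w f⟩

lemma T1Degree_eq_bot_of_subsingleton {𝓖 : Set (Finset W)}
    (hanti : ∀ G ∈ 𝓖, ∀ H ∈ 𝓖, G ⊆ H → G = H) {w : W} [Subsingleton (LinkComponents 𝓖 w)] :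
    T1Degree (squarefreeIdeal K 𝓖) (-Pi.single w 1) = ⊥ := by
  rw [T1Degree_eq_range 𝓖 hanti, LinearMap.range_eq_bot]
  refine LinearMap.ext fun f => ?_
  have : ∃ a, ∀ q, f q = a := by
    rcases isEmpty_or_nonempty (LinkComponents 𝓖 w) with h | ⟨⟨q⟩⟩
    · exact ⟨0, fun q => isEmptyElim q⟩
    · exact ⟨f q, fun q' => by rw [Subsingleton.elim q' q]⟩
  obtain ⟨a, ha⟩ := this
  exact (Submodule.Quotient.mk_eq_zero _).mpr (linkHom_mem_range_deltaStar_of_const hanti ha)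

/-- The dimension of `T¹` in degree `-e_w` is one less than the number of components. -/
lemma card_linkComponents [Finite W] {𝓖 : Set (Finset W)}
    (hanti : ∀ G ∈ 𝓖, ∀ H ∈ 𝓖, G ⊆ H → G = H) {w : W} {k : ℕ}
    (hk : Module.rank K (T1Degree (squarefreeIdeal K 𝓖) (-Pi.single w 1)) = (k : Cardinal)) :
    (IsEmpty (LinkComponents 𝓖 w) ∧ k = 0) ∨ Nat.card (LinkComponents 𝓖 w) = k + 1 := by
  have hk' := Module.finrank_eq_of_rank_eq hk
  rcases isEmpty_or_nonempty (LinkComponents 𝓖 w) with h | h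
  · refine Or.inl ⟨h, ?_⟩
    rw [← hk', T1Degree_eq_bot_of_subsingleton hanti, finrank_bot]
  · right
    have : Fintype (LinkComponents 𝓖 w) := Fintype.ofFinite _
    have hker : LinearMap.ker (((LinearMap.range (deltaStar (squarefreeIdeal K 𝓖))).mkQ.restrictScalars
        K) ∘ₗ linkHom K 𝓖 w) = Submodule.span K {fun _ => 1} := by
      ext f
      rw [LinearMap.mem_ker, Submodule.mem_span_singleton]
      refine (Submodule.Quotient.mk_eq_zero _).trans ⟨fun hf => ?_, ?_⟩
      · obtain ⟨a, ha⟩ := const_of_linkHom_mem_range_deltaStar hanti hf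
        exact ⟨a, by ext q; simp [ha]⟩
      · rintro ⟨a, rfl⟩
        exact linkHom_mem_range_deltaStar_of_const hanti (a := a) fun q => by simp
    have := LinearMap.finrank_range_add_finrank_ker
      (((LinearMap.range (deltaStar (squarefreeIdeal K 𝓖))).mkQ.restrictScalars
        K) ∘ₗ linkHom K 𝓖 w)
    rw [hker, ← T1Degree_eq_range 𝓖 hanti, hk', finrank_span_singleton, Module.finrank_fintype_fun_eq_card] at this
    · rw [Nat.card_eq_fintype_card, this]
    · obtain ⟨q⟩ := h
      exact fun h0 => one_ne_zero (congrFun h0 q)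

end CotangentDegree

/-! ### Splitting the vertex `i` according to a colouring of the minimal non-faces. -/

section SplitFamily

variable {K : Type*} [Field K] {V : Type*} [DecidableEq V] {A B : Type*}

/-- Minimal non-faces through `i` of different colours are not adjacent in the link of `i`. -/
def IsSeparating (Δ : SimplicialComplexOn V) (i : V) (c : Finset V → A) : Prop :=
  ∀ N ∈ minimalNonfaces Δ, ∀ N' ∈ minimalNonfaces Δ, i ∈ N → i ∈ N' → c N ≠ c N' →
    (N ∪ N').erase i ∉ Δ

/-- Merging colours leaves fewer pairs to test. Every intermediate ideal of the construction comes
from such a merged colouring. -/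
lemma IsSeparating.comp {Δ : SimplicialComplexOn V} {i : V} {c : Finset V → A}
    (h : IsSeparating Δ i c) (s : A → B) : IsSeparating Δ i (s ∘ c) :=
  fun N hN N' hN' hi hi' hne => h N hN N' hN' hi hi' fun he => hne (congrArg s he)

variable [DecidableEq A]

/-- Replace the vertex `i` by the new vertex `a`. -/
def splitVertex (i : V) (a : A) (j : V) : {j : V // j ≠ i} ⊕ A :=
  if h : j = i then Sum.inr a else Sum.inl ⟨j, h⟩

/-- Replace the vertex `i` of `N` by the colour of `N`. -/
def splitSet (i : V) (c : Finset V → A) (N : Finset V) : Finset ({j : V // j ≠ i} ⊕ A) :=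
  N.image (splitVertex i (c N))

lemma inl_mem_splitSet {i : V} {c : Finset V → A} {N : Finset V} {j : {j : V // j ≠ i}} :
    Sum.inl j ∈ splitSet i c N ↔ (j : V) ∈ N := by
  simp only [splitSet, Finset.mem_image, splitVertex]
  constructor
  · rintro ⟨v, hv, h⟩
    split_ifs at h
    obtain rfl := Sum.inl_injective h
    exact hv
  · exact fun h => ⟨j, h, by rw [dif_neg j.2]⟩

lemma inr_mem_splitSet {i : V} {c : Finset V → A} {N : Finset V} {a : A} :
    Sum.inr a ∈ splitSet i c N ↔ i ∈ N ∧ a = c N := by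
  simp only [splitSet, Finset.mem_image, splitVertex]
  constructor
  · rintro ⟨v, hv, h⟩
    split_ifs at h with hvi
    exact ⟨hvi ▸ hv, (Sum.inr_injective h).symm⟩
  · rintro ⟨h, rfl⟩
    exact ⟨i, h, by simp⟩

lemma splitSet_subset_iff_of_notMem {i : V} {c : Finset V → A} {M : Finset V} (hi : i ∉ M)
    {F : Finset ({j : V // j ≠ i} ⊕ A)} :
    splitSet i c M ⊆ F ↔ ∀ j : {j : V // j ≠ i}, (j : V) ∈ M → Sum.inl j ∈ F := by
  refine ⟨fun h j hj => h (inl_mem_splitSet.mpr hj), fun h => ?_⟩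
  rintro (j | a) hv
  · exact h j (inl_mem_splitSet.mp hv)
  · exact absurd (inr_mem_splitSet.mp hv).1 hi

lemma subset_of_splitSet_subset {i : V} {c c' : Finset V → A} {N N' : Finset V}
    (h : splitSet i c N ⊆ splitSet i c' N') : N ⊆ N' := by
  intro v hv
  by_cases hvi : v = i
  · subst hvi
    exact (inr_mem_splitSet.mp (h (inr_mem_splitSet.mpr ⟨hv, rfl⟩))).1
  · exact inl_mem_splitSet.mp (h (inl_mem_splitSet (j := ⟨v, hvi⟩) |>.mpr hv))

lemma image_splitSet [DecidableEq B] (i : V) (c : Finset V → A) (s : A → B) (N : Finset V) :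
    (splitSet i c N).image (Sum.map id s) = splitSet i (s ∘ c) N := by
  rw [splitSet, Finset.image_image, splitSet]
  refine Finset.image_congr fun v _ => ?_
  simp only [Function.comp_apply, splitVertex]
  split_ifs <;> rfl

lemma image_collapse_splitSet (i : V) (c : Finset V → A) (N : Finset V) :
    (splitSet i c N).image (Sum.elim (fun j : {j : V // j ≠ i} => (j : V)) (fun _ : A => i)) = N := by
  rw [splitSet, Finset.image_image]
  conv_rhs => rw [← Finset.image_id (s := N)]
  refine Finset.image_congr fun v _ => ?_
  simp only [Function.comp_apply, splitVertex]
  split_ifs with h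
  · exact h.symm
  · rfl

/-- A split set contains at most one new vertex. -/
lemma injOn_collapse_splitSet (i : V) (c : Finset V → A) (N : Finset V) :
    Set.InjOn (Sum.elim (fun j : {j : V // j ≠ i} => (j : V)) (fun _ : A => i)) (splitSet i c N : Set _) := by
  rintro (j | a) hv (j' | a') hv' h
  · exact congrArg Sum.inl (Subtype.ext h)
  · exact absurd h j.2
  · exact absurd h.symm j'.2
  · rw [Finset.mem_coe, inr_mem_splitSet] at hv hv'
    rw [hv.2, hv'.2]

lemma injOn_map_splitSet (i : V) (c : Finset V → A) (s : A → B) (N : Finset V) :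
    Set.InjOn (Sum.map id s) (splitSet i c N : Set ({j : V // j ≠ i} ⊕ A)) := by
  rintro (j | a) hv (j' | a') hv' h
  · exact congrArg Sum.inl (Sum.inl_injective h)
  · simp at h
  · simp at h
  · rw [Finset.mem_coe, inr_mem_splitSet] at hv hv'
    rw [hv.2, hv'.2]

/-- The minimal non-faces of `Δ` in which `i` is replaced according to the colouring `c`. -/
def splitFamily (Δ : SimplicialComplexOn V) (i : V) (c : Finset V → A) :
    Set (Finset ({j : V // j ≠ i} ⊕ A)) := splitSet i c '' minimalNonfaces Δ

lemma splitFamily_antichain (Δ : SimplicialComplexOn V) (i : V) (c : Finset V → A) :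
    ∀ G ∈ splitFamily Δ i c, ∀ H ∈ splitFamily Δ i c, G ⊆ H → G = H := by
  rintro _ ⟨N, hN, rfl⟩ _ ⟨N', hN', rfl⟩ h
  rw [eq_of_minimalNonfaces_subset hN hN' (subset_of_splitSet_subset h)]

lemma map_rename_splitFamily [DecidableEq B] (Δ : SimplicialComplexOn V) (i : V) (c : Finset V → A)
    (s : A → B) :
    (squarefreeIdeal K (splitFamily Δ i c)).map (rename (R := K) (Sum.map id s)) =
      squarefreeIdeal K (splitFamily Δ i (s ∘ c)) := by
  rw [map_rename_squarefreeIdeal, splitFamily, splitFamily, Set.image_image]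
  · simp_rw [image_splitSet]
  · rintro _ ⟨N, -, rfl⟩
    exact injOn_map_splitSet i c s N

lemma map_rename_collapse_splitFamily (Δ : SimplicialComplexOn V) (i : V) (c : Finset V → A) :
    (squarefreeIdeal K (splitFamily Δ i c)).map
      (rename (R := K) (Sum.elim (fun j : {j : V // j ≠ i} => (j : V)) (fun _ : A => i))) =
      squarefreeIdeal K (minimalNonfaces Δ) := by
  rw [map_rename_squarefreeIdeal, splitFamily, Set.image_image]
  · simp_rw [image_collapse_splitSet, Set.image_id']
  · rintro _ ⟨N, -, rfl⟩
    exact injOn_collapse_splitSet i c N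

/-- For `N` and `N'` of different colours, a minimal non-face inside `(N ∪ N') \ i` avoids `i`.
Splitting therefore adds no new vertex to it, and it serves as the generator required by the
criterion. -/
lemma IsSeparating.mem_of_X_sub_X_mul {Δ : SimplicialComplexOn V} {i : V} {c : Finset V → A}
    (h : IsSeparating Δ i c) {a b : A} (hab : a ≠ b)
    {f : MvPolynomial ({j : V // j ≠ i} ⊕ A) K}
    (hf : (X (Sum.inr a) - X (Sum.inr b)) * f ∈ squarefreeIdeal K (splitFamily Δ i c)) :
    f ∈ squarefreeIdeal K (splitFamily Δ i c) := by
  refine mem_squarefreeIdeal_of_X_sub_X_mul (Sum.inr_injective.ne hab) ?_ hf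
  rintro _ ⟨N, hN, rfl⟩ _ ⟨N', hN', rfl⟩ ha hb
  rw [inr_mem_splitSet] at ha hb
  obtain ⟨M, hM, hMs⟩ := exists_minimalNonface_subset
    (h N hN N' hN' ha.1 hb.1 (by rw [← ha.2, ← hb.2]; exact hab))
  have hiM : i ∉ M := fun hi => Finset.notMem_erase i _ (hMs hi)
  refine ⟨_, ⟨M, hM, rfl⟩, (splitSet_subset_iff_of_notMem hiM).mpr fun j hj => ?_⟩
  have := Finset.mem_of_mem_erase (hMs hj)
  simpa [inl_mem_splitSet] using this

/-- The simplicial complex whose non-faces are generated by `splitFamily Δ i c`. -/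
def splitComplex (Δ : SimplicialComplexOn V) (i : V) (c : Finset V → A) :
    SimplicialComplexOn ({j : V // j ≠ i} ⊕ A) where
  carrier := {F | ∀ G ∈ splitFamily Δ i c, ¬ G ⊆ F}
  lower' := fun _ _ hFF hF G hG hGF => hF G hG (hGF.trans hFF)

lemma stanleyReisnerIdeal_splitComplex (Δ : SimplicialComplexOn V) (i : V) (c : Finset V → A) :
    stanleyReisnerIdeal K (splitComplex Δ i c) = squarefreeIdeal K (splitFamily Δ i c) := by
  refine stanleyReisnerIdeal_eq_of_forall fun N => ?_
  change ¬ (∀ G ∈ splitFamily Δ i c, ¬ G ⊆ N) ↔ _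
  push Not
  rfl

/-- If every colour class is connected, then so is the graph of each new vertex. -/
lemma subsingleton_linkComponents_splitFamily {Δ : SimplicialComplexOn V} {i : V}
    {c : Finset V → A} (h : IsSeparating Δ i c)
    (hc : ∀ N N' : {N : Finset V // N ∈ minimalNonfaces Δ ∧ i ∈ N}, c N.1 = c N'.1 →
      linkComponent N.1 N.2.1 N.2.2 = linkComponent N'.1 N'.2.1 N'.2.2) (a : A) :
    Subsingleton (LinkComponents (splitFamily Δ i c) (Sum.inr a)) := by
  constructor
  rintro ⟨_, ⟨N, hN, rfl⟩, ha⟩ ⟨_, ⟨N', hN', rfl⟩, ha'⟩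
  have hNa := inr_mem_splitSet.mp ha
  have hNa' := inr_mem_splitSet.mp ha'
  -- Components of the old graph are transported to the graph at `a`. The colour condition is a
  -- hypothesis inside `μ`, so `μ` is defined on every minimal non-face through `i` and can descend
  -- to the quotient.
  let μ : {N : Finset V // N ∈ minimalNonfaces Δ ∧ i ∈ N} → Prop := fun M =>
    ∀ hM : a = c M.1, linkComponent (𝓖 := splitFamily Δ i c) (splitSet i c M.1) ⟨M.1, M.2.1, rfl⟩
      (inr_mem_splitSet.mpr ⟨M.2.2, hM⟩) =
        linkComponent (𝓖 := splitFamily Δ i c) (splitSet i c N) ⟨N, hN, rfl⟩ ha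
  have hμ : ∀ M M', LinkAdj (minimalNonfaces Δ) i M M' → μ M = μ M' := by
    intro M M' hadj
    have hcol : c M.1 = c M'.1 := by
      by_contra hne
      obtain ⟨H, hH, hHs⟩ := exists_minimalNonface_subset
        (h M.1 M.2.1 M'.1 M'.2.1 M.2.2 M'.2.2 hne)
      exact hadj H hH hHs
    have hcomp : ∀ (hM : a = c M.1) (hM' : a = c M'.1),
        linkComponent (𝓖 := splitFamily Δ i c) (splitSet i c M.1) ⟨M.1, M.2.1, rfl⟩
          (inr_mem_splitSet.mpr ⟨M.2.2, hM⟩) =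
        linkComponent (𝓖 := splitFamily Δ i c) (splitSet i c M'.1) ⟨M'.1, M'.2.1, rfl⟩
          (inr_mem_splitSet.mpr ⟨M'.2.2, hM'⟩) := by
      intro hM hM'
      refine Quot.sound ?_
      rintro _ ⟨P, hP, rfl⟩ hPs
      -- Both split sets have `a` as their only new vertex, and it has been erased.
      have hiP : i ∉ P := by
        intro hiP
        have h1 := hPs (inr_mem_splitSet.mpr ⟨hiP, rfl⟩)
        simp only [Finset.mem_erase, Finset.mem_union, inr_mem_splitSet, ← hM, ← hM'] at h1
        rcases h1.2 with h2 | h2 <;> exact h1.1 (by rw [h2.2])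
      refine hadj P hP fun v hv => ?_
      have hvi : v ≠ i := fun e => hiP (e ▸ hv)
      have h1 := (splitSet_subset_iff_of_notMem hiP).mp hPs ⟨v, hvi⟩ hv
      simpa [inl_mem_splitSet, hvi] using h1
    refine propext ⟨fun h1 hM' => ?_, fun h1 hM => ?_⟩
    · rw [← hcomp (hM'.trans hcol.symm) hM']
      exact h1 (hM'.trans hcol.symm)
    · rw [hcomp hM (hM.trans hcol)]
      exact h1 (hM.trans hcol)
  have h1 : μ ⟨N, hN, hNa.1⟩ = μ ⟨N', hN', hNa'.1⟩ :=
    congrArg (Quot.lift μ hμ) (hc ⟨N, hN, hNa.1⟩ ⟨N', hN', hNa'.1⟩ (hNa.2.symm.trans hNa'.2))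
  have h2 : μ ⟨N, hN, hNa.1⟩ := fun _ => rfl
  rw [h1] at h2
  exact (h2 hNa'.2).symm

lemma T1Degree_splitFamily_eq_bot {Δ : SimplicialComplexOn V} {i : V}
    {c : Finset V → A} (h : IsSeparating Δ i c)
    (hc : ∀ N N' : {N : Finset V // N ∈ minimalNonfaces Δ ∧ i ∈ N}, c N.1 = c N'.1 →
      linkComponent N.1 N.2.1 N.2.2 = linkComponent N'.1 N'.2.1 N'.2.2)
    (b : {j : V // j ≠ i} ⊕ A → ℕ) (hb : ∀ j, b (Sum.inl j) = 0) :
    T1Degree (squarefreeIdeal K (splitFamily Δ i c)) (fun v => -(b v : ℤ)) = ⊥ := by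
  by_cases hs : ∃ a : A, b = Pi.single (Sum.inr a) 1
  · obtain ⟨a, rfl⟩ := hs
    have := subsingleton_linkComponents_splitFamily h hc a
    rw [← T1Degree_eq_bot_of_subsingleton (K := K) (splitFamily_antichain Δ i c)
      (w := Sum.inr a)]
    congr 1
    ext v
    simp [Pi.single_apply]
  · refine T1Degree_eq_bot_of_forall ?_
    rintro _ ⟨N, hN, rfl⟩
    by_contra! hcon
    obtain ⟨h0, hle⟩ := hcon
    obtain ⟨v, hv⟩ := Function.ne_iff.mp h0
    have hle' : ∀ v, b v ≤ vertexExponent (splitSet i c N) v := fun v => by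
      have := hle v; omega
    rcases v with j | a
    · simp [hb] at hv
    · have hv' : b (Sum.inr a) ≠ 0 := by simpa using hv
      -- A generator contains only the new vertex of its own colour, with exponent one, so a nonzero
      -- `b` below its exponent must be a unit vector.
      have key : ∀ a', b (Sum.inr a') ≠ 0 → a' = c N ∧ b (Sum.inr a') = 1 := by
        intro a' ha'
        have h1 := hle' (Sum.inr a')
        rw [vertexExponent_apply] at h1
        split_ifs at h1 with hm
        · exact ⟨(inr_mem_splitSet.mp hm).2, by omega⟩
        · omega
      refine hs ⟨a, ?_⟩
      ext (j | a')
      · simp [hb]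
      · by_cases ha' : a' = a
        · subst ha'; simp [(key a' hv').2]
        · rw [Pi.single_eq_of_ne (Sum.inr_injective.ne ha')]
          by_contra h1
          exact ha' ((key a' h1).1.trans (key a hv').1.symm)

/-- The colouring of the minimal non-faces through `i` by connected components. -/
lemma exists_separating_colouring [Finite V] (Δ : SimplicialComplexOn V) (i : V) {k : ℕ}
    (hk : Module.rank K (T1Degree (stanleyReisnerIdeal K Δ) (-Pi.single i 1)) = (k : Cardinal)) :
    ∃ c : Finset V → Fin (k + 1), IsSeparating Δ i c ∧
      (∀ N N' : {N : Finset V // N ∈ minimalNonfaces Δ ∧ i ∈ N}, c N.1 = c N'.1 →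
        linkComponent N.1 N.2.1 N.2.2 = linkComponent N'.1 N'.2.1 N'.2.2) ∧
      (0 < k → ∀ l, ∃ N ∈ minimalNonfaces Δ, i ∈ N ∧ c N = l) := by
  classical
  rw [stanleyReisnerIdeal_eq_squarefreeIdeal] at hk
  rcases card_linkComponents
    (fun _ hG _ hH => eq_of_minimalNonfaces_subset hG hH) hk with ⟨hE, rfl⟩ | hcard
  -- With no minimal non-face through `i` the single colour is not attained; this is why
  -- surjectivity is claimed only for `0 < k`.
  · refine ⟨fun _ => 0, fun _ _ _ _ _ _ h => absurd rfl h, fun N _ _ => ?_,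
      fun h => absurd h (lt_irrefl _)⟩
    exact hE.elim (linkComponent N.1 N.2.1 N.2.2)
  · let e := Finite.equivFinOfCardEq hcard
    let c : Finset V → Fin (k + 1) := fun N =>
      if h : N ∈ minimalNonfaces Δ ∧ i ∈ N then e (linkComponent N h.1 h.2) else 0
    have hc : ∀ N (h1 : N ∈ minimalNonfaces Δ) (h2 : i ∈ N), c N = e (linkComponent N h1 h2) :=
      fun N h1 h2 => dif_pos ⟨h1, h2⟩
    refine ⟨c, fun N hN N' hN' hi hi' hne hmem => hne ?_, fun N N' h => ?_, fun _ l => ?_⟩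
    · rw [hc N hN hi, hc N' hN' hi']
      congr 1
      exact Quot.sound fun H hH hHs => hH.1 (Δ.lower hHs hmem)
    · rw [hc _ N.2.1 N.2.2, hc _ N'.2.1 N'.2.2] at h
      exact e.injective h
    · obtain ⟨⟨N, hN, hi⟩, hq⟩ := Quot.exists_rep (e.symm l)
      refine ⟨N, hN, hi, ?_⟩
      rw [hc N hN hi, ← e.apply_symm_apply l, ← hq]
      rfl

end SplitFamily

/-! ### Identifying the new variables: regular sequence, quotient and iterated separation. -/

section Assembly

variable {K : Type*} [Field K]

/-- Modulo `D` the renaming acts as the identity. -/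
lemma sub_rename_mem {W : Type*} {D : Ideal (MvPolynomial W K)} {σ : W → W}
    (h : ∀ v, X v - X (σ v) ∈ D) (f : MvPolynomial W K) : f - rename σ f ∈ D := by
  have : (Ideal.Quotient.mkₐ K D).comp (rename σ) = Ideal.Quotient.mkₐ K D := by
    refine MvPolynomial.algHom_ext fun v => ?_
    simp only [AlgHom.comp_apply, rename_X, Ideal.Quotient.mkₐ_eq_mk]
    exact (Ideal.Quotient.eq.mpr (h v)).symm
  exact Ideal.Quotient.eq.mp (AlgHom.congr_fun this f).symm

lemma map_rename_le {W : Type*} {D J : Ideal (MvPolynomial W K)} {σ : W → W}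
    (h : ∀ v, X v - X (σ v) ∈ D) : J.map (rename (R := K) σ) ≤ J ⊔ D := by
  rw [Ideal.map_le_iff_le_comap]
  intro f hf
  have h1 := sub_mem (Submodule.mem_sup_left hf : f ∈ J ⊔ D)
    (Submodule.mem_sup_right (sub_rename_mem h f))
  rwa [sub_sub_cancel] at h1

lemma map_rename_rename {W W' W'' : Type*} (I : Ideal (MvPolynomial W K)) (f : W → W')
    (g : W' → W'') :
    (I.map (rename (R := K) f)).map (rename (R := K) g) = I.map (rename (R := K) (g ∘ f)) := by
  rw [Ideal.map_mapₐ]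
  congr 1
  refine AlgHom.ext fun p => ?_
  exact rename_rename f g p

variable {V : Type*}

variable (K) in
/-- The ideal generated by the first `m` of the differences of consecutive new variables. -/
def differenceIdeal (i : V) (k m : ℕ) : Ideal (MvPolynomial (SplitVertices i k) K) :=
  Ideal.span {p | ∃ l : Fin k, (l : ℕ) < m ∧ p = X (Sum.inr l.succ) - X (Sum.inr l.castSucc)}

lemma ofList_take_differenceSequence {i : V} {k : ℕ}
    (Δ' : SimplicialComplexOn (SplitVertices i k)) (m : ℕ) :
    Ideal.ofList ((differenceSequence K i k Δ').take m) =
      (differenceIdeal K i k m).map (Ideal.Quotient.mk (stanleyReisnerIdeal K Δ')) := by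
  rw [differenceIdeal, Ideal.map_span, Ideal.ofList]
  congr 1
  ext q
  simp only [Set.mem_ofPred_eq, Set.mem_image, List.mem_take_iff_getElem, differenceSequence,
    List.length_ofFn, List.getElem_ofFn]
  constructor
  · rintro ⟨l, hl, rfl⟩
    exact ⟨_, ⟨⟨l, by omega⟩, by simp; omega, rfl⟩, rfl⟩
  · rintro ⟨_, ⟨l, hl, rfl⟩, rfl⟩
    exact ⟨l, by have := l.2; omega, rfl⟩

lemma mk_mem_ofList_take {i : V} {k : ℕ} {Δ' : SimplicialComplexOn (SplitVertices i k)} {m : ℕ}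
    {f : MvPolynomial (SplitVertices i k) K} :
    Ideal.Quotient.mk (stanleyReisnerIdeal K Δ') f ∈
      Ideal.ofList ((differenceSequence K i k Δ').take m) ↔
    f ∈ stanleyReisnerIdeal K Δ' ⊔ differenceIdeal K i k m := by
  rw [ofList_take_differenceSequence, Ideal.mem_quotient_iff_mem_sup, sup_comm]

lemma X_sub_X_zero_mem_differenceIdeal (i : V) (k : ℕ) {m l : ℕ} (hl : l < k + 1) (hlm : l ≤ m) :
    (X (Sum.inr ⟨l, hl⟩) - X (Sum.inr 0) : MvPolynomial (SplitVertices i k) K) ∈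
      differenceIdeal K i k m := by
  induction l with
  | zero => rw [show (⟨0, hl⟩ : Fin (k + 1)) = 0 from rfl, sub_self]; exact zero_mem _
  | succ l ih =>
    have h1 : (X (Sum.inr ⟨l + 1, hl⟩) - X (Sum.inr ⟨l, by omega⟩) :
        MvPolynomial (SplitVertices i k) K) ∈ differenceIdeal K i k m :=
      Ideal.subset_span ⟨⟨l, by omega⟩, by simp; omega, rfl⟩
    have h2 := add_mem h1 (ih (by omega) (by omega))
    rwa [sub_add_sub_cancel] at h2

/-- Identify the first `m + 1` new vertices. -/
def foldColour (k m : ℕ) (l : Fin (k + 1)) : Fin (k + 1) := if (l : ℕ) ≤ m then 0 else l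

lemma X_sub_X_fold_mem_differenceIdeal (i : V) (k m : ℕ) (v : SplitVertices i k) :
    (X v - X (Sum.map id (foldColour k m) v) : MvPolynomial (SplitVertices i k) K) ∈
      differenceIdeal K i k m := by
  rcases v with j | l
  · simp
  · simp only [Sum.map_inr, foldColour]
    split_ifs with h
    · exact X_sub_X_zero_mem_differenceIdeal i k l.2 h
    · simp

/-- Identify the colours above `m` with `0`. -/
def truncateColour (k m : ℕ) (l : Fin (k + 1)) : Fin (m + 1) :=
  if h : (l : ℕ) ≤ m then ⟨l, Nat.lt_succ_of_le h⟩ else 0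

/-- The `m`-th ideal uses colours truncated at `m`. By this identity, merging colour `m + 1` into
`0` turns the next ideal back into this one. -/
lemma truncateColour_truncateColour (k m : ℕ) (l : Fin (k + 1)) :
    truncateColour (m + 1) m (truncateColour k (m + 1) l) = truncateColour k m l := by
  unfold truncateColour
  by_cases h : (l : ℕ) ≤ m
  · simp [h, Nat.le_succ_of_le h]
  · by_cases h' : (l : ℕ) ≤ m + 1
    · simp [h, h']
    · simp [h, h']

/-- `adjoinVertex` as an equivalence. -/
def adjoinEquiv (i : V) (m : ℕ) : Option (SplitVertices i m) ≃ SplitVertices i (m + 1) :=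
  Equiv.ofBijective (adjoinVertex i m) <| by
    constructor
    · rintro (_ | j | l) (_ | j' | l') h <;> simp_all [adjoinVertex, Fin.ext_iff] <;> omega
    · rintro (j | l)
      · exact ⟨some (Sum.inl j), rfl⟩
      · induction l using Fin.lastCases with
        | last => exact ⟨none, rfl⟩
        | cast l => exact ⟨some (Sum.inr l), rfl⟩

lemma elim_adjoinEquiv_symm (i : V) (m : ℕ) :
    (fun o : Option (SplitVertices i m) => o.elim (Sum.inr 0) id) ∘ (adjoinEquiv i m).symm =
      Sum.map id (truncateColour (m + 1) m) := by
  rw [Equiv.comp_symm_eq]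
  ext o : 1
  change _ = Sum.map id (truncateColour (m + 1) m) (adjoinVertex i m o)
  rcases o with _ | j | l
  · simp [adjoinVertex, truncateColour]
  · simp [adjoinVertex]
  · have : (l : ℕ) ≤ m := Nat.lt_succ_iff.mp l.2
    simp [adjoinVertex, truncateColour, this]

variable [DecidableEq V]

/-- Passing to the quotient by the first `m` differences amounts to folding colours `0, …, m` into
`0`. The folded colouring is still separating; membership is then pulled back because renaming is
the identity modulo the differences. -/
lemma mem_sup_differenceIdeal_of_mul_mem {Δ : SimplicialComplexOn V} {i : V} {k : ℕ}
    {c : Finset V → Fin (k + 1)} (hc : IsSeparating Δ i c) (m : Fin k)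
    {f : MvPolynomial (SplitVertices i k) K}
    (hf : (X (Sum.inr m.succ) - X (Sum.inr m.castSucc)) * f ∈
      squarefreeIdeal K (splitFamily Δ i c) ⊔ differenceIdeal K i k m) :
    f ∈ squarefreeIdeal K (splitFamily Δ i c) ⊔ differenceIdeal K i k m := by
  set σ : SplitVertices i k → SplitVertices i k := Sum.map id (foldColour k m) with hσ
  set J := squarefreeIdeal K (splitFamily Δ i c)
  have hJ : J.map (rename (R := K) σ) = squarefreeIdeal K (splitFamily Δ i (foldColour k m ∘ c)) :=
    map_rename_splitFamily Δ i c _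
  have hle : J ⊔ differenceIdeal K i k m ≤ (J.map (rename (R := K) σ)).comap (rename (R := K) σ) := by
    refine sup_le Ideal.le_comap_map ?_
    rw [differenceIdeal, Ideal.span_le]
    rintro _ ⟨l, hl, rfl⟩
    have h1 : foldColour k m l.succ = 0 := if_pos (by simp; omega)
    have h2 : foldColour k m l.castSucc = 0 := if_pos (by simp; omega)
    simp [hσ, h1, h2]
  have h1 := hle hf
  rw [Ideal.mem_comap, hJ, map_mul, map_sub, rename_X, rename_X, hσ, Sum.map_inr, Sum.map_inr]
    at h1
  -- Folding fixes the colour `m + 1` and sends `m` to `0`, so the two colours remain distinct.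
  have h2 := (hc.comp (foldColour k m)).mem_of_X_sub_X_mul (by simp [foldColour]) h1
  rw [← hJ] at h2
  have h3 := map_rename_le (X_sub_X_fold_mem_differenceIdeal i k m) h2
  have h4 := sub_rename_mem (X_sub_X_fold_mem_differenceIdeal (K := K) i k m) f
  have h5 := add_mem (Submodule.mem_sup_right h4 : _ ∈ J ⊔ differenceIdeal K i k m) h3
  rwa [sub_add_cancel] at h5

lemma isWeaklyRegular_differenceSequence {Δ : SimplicialComplexOn V} {i : V} {k : ℕ}
    {c : Finset V → Fin (k + 1)} (hc : IsSeparating Δ i c) :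
    RingTheory.Sequence.IsWeaklyRegular (StanleyReisnerRing K (splitComplex Δ i c))
      (differenceSequence K i k (splitComplex Δ i c)) := by
  rw [RingTheory.Sequence.isWeaklyRegular_iff]
  intro m hm
  have hmk : m < k := by simpa [differenceSequence] using hm
  rw [isSMulRegular_quotient_iff_mem_of_smul_mem]
  intro x hx
  obtain ⟨f, rfl⟩ := Ideal.Quotient.mk_surjective x
  rw [smul_eq_mul, Ideal.mul_top] at hx ⊢
  have he : (differenceSequence K i k (splitComplex Δ i c))[m] =
      Ideal.Quotient.mk _ (X (Sum.inr (Fin.succ ⟨m, hmk⟩)) -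
        X (Sum.inr (Fin.castSucc ⟨m, hmk⟩))) := by
    simp only [differenceSequence, List.getElem_ofFn]
  rw [he, smul_eq_mul, ← map_mul, mk_mem_ofList_take, stanleyReisnerIdeal_splitComplex] at hx
  rw [mk_mem_ofList_take, stanleyReisnerIdeal_splitComplex]
  exact mem_sup_differenceIdeal_of_mul_mem hc ⟨m, hmk⟩ hx

lemma rename_collapse_mem_iff {Δ : SimplicialComplexOn V} {i : V} {k : ℕ}
    {c : Finset V → Fin (k + 1)} {f : MvPolynomial (SplitVertices i k) K} :
    rename (R := K) (collapseVertex i k) f ∈ stanleyReisnerIdeal K Δ ↔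
      f ∈ stanleyReisnerIdeal K (splitComplex Δ i c) ⊔ differenceIdeal K i k k := by
  rw [stanleyReisnerIdeal_splitComplex, stanleyReisnerIdeal_eq_squarefreeIdeal]
  have hmap : (squarefreeIdeal K (splitFamily Δ i c)).map
      (rename (R := K) (collapseVertex i k)) = squarefreeIdeal K (minimalNonfaces Δ) :=
    map_rename_collapse_splitFamily Δ i c
  constructor
  · intro hf
    -- Collapsing and then returning `i` to `v_0` is the identity modulo the differences, so
    -- membership downstairs lifts.
    have hρ : ∀ v : SplitVertices i k, (X v - X ((splitVertex i (0 : Fin (k + 1)) ∘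
        collapseVertex i k) v) : MvPolynomial (SplitVertices i k) K) ∈
        differenceIdeal K i k k := by
      rintro (j | l)
      · have := j.2
        simp [collapseVertex, splitVertex, this]
      · have := X_sub_X_zero_mem_differenceIdeal (K := K) i k l.2 (Nat.lt_succ_iff.mp l.2)
        simpa [collapseVertex, splitVertex] using this
    have h1 := Ideal.mem_map_of_mem (rename (R := K) (splitVertex i (0 : Fin (k + 1)))) hf
    rw [← hmap, map_rename_rename, rename_rename] at h1
    have h2 := add_mem (Submodule.mem_sup_right (sub_rename_mem hρ f) :
      _ ∈ squarefreeIdeal K (splitFamily Δ i c) ⊔ _) (map_rename_le hρ h1)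
    rwa [sub_add_cancel] at h2
  · have hle : squarefreeIdeal K (splitFamily Δ i c) ⊔ differenceIdeal K i k k ≤
        (squarefreeIdeal K (minimalNonfaces Δ)).comap (rename (R := K) (collapseVertex i k)) := by
      refine sup_le (hmap ▸ Ideal.le_comap_map) ?_
      rw [differenceIdeal, Ideal.span_le]
      rintro _ ⟨l, hl, rfl⟩
      simp [collapseVertex]
    exact fun hf => hle hf

lemma exists_algEquiv_collapse (Δ : SimplicialComplexOn V) (i : V) {k : ℕ}
    (c : Finset V → Fin (k + 1)) :
    ∃ e : (StanleyReisnerRing K (splitComplex Δ i c) ⧸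
        Ideal.ofList (differenceSequence K i k (splitComplex Δ i c))) ≃ₐ[K]
          StanleyReisnerRing K Δ,
      ∀ v : SplitVertices i k,
        e (Ideal.Quotient.mk (Ideal.ofList (differenceSequence K i k (splitComplex Δ i c)))
            (Ideal.Quotient.mk (stanleyReisnerIdeal K (splitComplex Δ i c)) (X v))) =
          Ideal.Quotient.mk (stanleyReisnerIdeal K Δ) (X (collapseVertex i k v)) := by
  have hlist : differenceSequence K i k (splitComplex Δ i c) =
      (differenceSequence K i k (splitComplex Δ i c)).take k := by
    rw [List.take_of_length_le]
    simp [differenceSequence]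
  have hmem : ∀ f, Ideal.Quotient.mk (stanleyReisnerIdeal K (splitComplex Δ i c)) f ∈
      Ideal.ofList (differenceSequence K i k (splitComplex Δ i c)) ↔
      rename (R := K) (collapseVertex i k) f ∈ stanleyReisnerIdeal K Δ := by
    intro f
    rw [hlist, mk_mem_ofList_take, rename_collapse_mem_iff]
  let π : MvPolynomial (SplitVertices i k) K →ₐ[K] StanleyReisnerRing K Δ :=
    (Ideal.Quotient.mkₐ K _).comp (rename (collapseVertex i k))
  have hπ : ∀ f, π f = 0 ↔ rename (R := K) (collapseVertex i k) f ∈ stanleyReisnerIdeal K Δ :=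
    fun f => Ideal.Quotient.eq_zero_iff_mem
  let π₁ : StanleyReisnerRing K (splitComplex Δ i c) →ₐ[K] StanleyReisnerRing K Δ :=
    Ideal.Quotient.liftₐ _ π fun f hf =>
      (hπ f).mpr (rename_collapse_mem_iff.mpr (Submodule.mem_sup_left hf))
  let π₂ : (StanleyReisnerRing K (splitComplex Δ i c) ⧸
        Ideal.ofList (differenceSequence K i k (splitComplex Δ i c))) →ₐ[K]
      StanleyReisnerRing K Δ := Ideal.Quotient.liftₐ _ π₁ fun q hq => by
    obtain ⟨f, rfl⟩ := Ideal.Quotient.mk_surjective q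
    exact (hπ f).mpr ((hmem f).mp hq)
  have hπ₂ : ∀ f, π₂ (Ideal.Quotient.mk _ (Ideal.Quotient.mk _ f)) = π f := fun f => rfl
  refine ⟨AlgEquiv.ofBijective π₂ ⟨?_, ?_⟩, fun v => ?_⟩
  · rw [injective_iff_map_eq_zero]
    intro q hq
    obtain ⟨q, rfl⟩ := Ideal.Quotient.mk_surjective q
    obtain ⟨f, rfl⟩ := Ideal.Quotient.mk_surjective q
    rw [Ideal.Quotient.eq_zero_iff_mem, hmem, ← hπ, ← hπ₂]
    exact hq
  · intro q
    obtain ⟨g, rfl⟩ := Ideal.Quotient.mk_surjective q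
    refine ⟨Ideal.Quotient.mk _ (Ideal.Quotient.mk _ (rename (splitVertex i 0) g)), ?_⟩
    rw [hπ₂]
    change Ideal.Quotient.mk _ (rename (collapseVertex i k) (rename (splitVertex i 0) g)) = _
    rw [rename_rename]
    have : collapseVertex i k ∘ splitVertex i 0 = id := by
      ext v
      simp only [Function.comp_apply, splitVertex]
      split_ifs with h
      · exact h.symm
      · rfl
    rw [this, rename_id_apply]
  · change Ideal.Quotient.mk _ (rename (collapseVertex i k) (X v)) = _
    rw [rename_X]

lemma isRegular_differenceSequence {Δ : SimplicialComplexOn V} {i : V} {k : ℕ}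
    {c : Finset V → Fin (k + 1)} (hc : IsSeparating Δ i c) (h0 : (∅ : Finset V) ∈ Δ) :
    RingTheory.Sequence.IsRegular (StanleyReisnerRing K (splitComplex Δ i c))
      (differenceSequence K i k (splitComplex Δ i c)) := by
  refine ⟨isWeaklyRegular_differenceSequence hc, fun htop => ?_⟩
  obtain ⟨e, -⟩ := exists_algEquiv_collapse (K := K) Δ i c
  rw [smul_eq_mul, Ideal.mul_top] at htop
  have h1 : (1 : StanleyReisnerRing K (splitComplex Δ i c) ⧸
      Ideal.ofList (differenceSequence K i k (splitComplex Δ i c))) = 0 := by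
    rw [← map_one (Ideal.Quotient.mk _), Ideal.Quotient.eq_zero_iff_mem, ← htop]
    trivial
  have h2 : (1 : StanleyReisnerRing K Δ) = 0 := by
    rw [← map_one e, h1, map_zero]
  -- If `1` lies in the ideal, some minimal non-face is contained in the empty set.
  rw [← map_one (Ideal.Quotient.mk _), Ideal.Quotient.eq_zero_iff_mem,
    stanleyReisnerIdeal_eq_squarefreeIdeal, ← C_1, C_apply,
    monomial_mem_squarefreeIdeal one_ne_zero] at h2
  obtain ⟨G, hG, hG0⟩ := h2
  exact hG.1 (Δ.lower hG0 (by simpa using h0))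

/-- The step splits colour `m + 1` off from `0`. The generators form an antichain, so all are
minimal, and surjectivity of the colouring supplies ones containing each of the two variables. -/
lemma isSeparation_splitFamily {Δ : SimplicialComplexOn V} {i : V} {k m : ℕ} (hm : m < k)
    {c : Finset V → Fin (k + 1)} (hc : IsSeparating Δ i c)
    (hsurj : ∀ l, ∃ N ∈ minimalNonfaces Δ, i ∈ N ∧ c N = l) :
    IsSeparation (squarefreeIdeal K (splitFamily Δ i (truncateColour k m ∘ c))) (Sum.inr 0)
      ((squarefreeIdeal K (splitFamily Δ i (truncateColour k (m + 1) ∘ c))).comap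
        (rename (R := K) (adjoinVertex i m))) := by
  set J := squarefreeIdeal K (splitFamily Δ i (truncateColour k (m + 1) ∘ c)) with hJ
  set e := adjoinEquiv i m
  have hcomap : J.comap (rename (R := K) (adjoinVertex i m)) =
      squarefreeIdeal K (Finset.image e.symm '' splitFamily Δ i (truncateColour k (m + 1) ∘ c)) := by
    rw [← map_rename_squarefreeIdeal _ fun _ _ => e.symm.injective.injOn]
    exact comap_rename_equiv e J
  have hanti : ∀ G ∈ Finset.image e.symm '' splitFamily Δ i (truncateColour k (m + 1) ∘ c),
      ∀ H ∈ Finset.image e.symm '' splitFamily Δ i (truncateColour k (m + 1) ∘ c),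
      G ⊆ H → G = H := by
    rintro _ ⟨G, hG, rfl⟩ _ ⟨H, hH, rfl⟩ h
    rw [Finset.image_subset_image_iff e.symm.injective] at h
    rw [splitFamily_antichain Δ i _ G hG H hH h]
  have hgen : ∀ (o : Option (SplitVertices i m)) (l : Fin (k + 1)),
      adjoinVertex i m o = Sum.inr (truncateColour k (m + 1) l) →
      ∃ u, IsMinimalGenerator (J.comap (rename (R := K) (adjoinVertex i m))) u ∧ u o ≠ 0 := by
    intro o l ho
    obtain ⟨N, hN, hi, hl⟩ := hsurj l
    refine ⟨vertexExponent ((splitSet i (truncateColour k (m + 1) ∘ c) N).image e.symm), ?_, ?_⟩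
    · rw [hcomap]
      exact isMinimalGenerator_vertexExponent hanti ⟨_, ⟨N, hN, rfl⟩, rfl⟩
    · rw [vertexExponent_of_mem]
      · exact one_ne_zero
      · refine Finset.mem_image.mpr ⟨_, inr_mem_splitSet.mpr ⟨hi, rfl⟩, ?_⟩
        rw [Equiv.symm_apply_eq, Function.comp_apply, hl]
        exact ho.symm
  refine ⟨isSquarefreeMonomialIdeal_squarefreeIdeal _, ?_, ?_, ?_, ?_, ?_⟩
  · obtain ⟨s, -, hs⟩ := isSquarefreeMonomialIdeal_squarefreeIdeal (K := K)
      (Finset.image e.symm '' splitFamily Δ i (truncateColour k (m + 1) ∘ c))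
    exact ⟨s, hcomap.trans hs⟩
  · have h1 : J.comap (rename (R := K) (adjoinVertex i m)) = J.map (rename (R := K) e.symm) :=
      comap_rename_equiv e J
    rw [h1, map_rename_rename, elim_adjoinEquiv_symm, hJ, map_rename_splitFamily]
    refine congrArg (fun c => squarefreeIdeal K (splitFamily Δ i c)) (funext fun N => ?_)
    exact truncateColour_truncateColour k m (c N)
  · exact hgen (some (Sum.inr 0)) 0 (by simp [adjoinVertex, truncateColour])
  · refine hgen none ⟨m + 1, by omega⟩ ?_
    simp [adjoinVertex, truncateColour, Fin.last]
  · rw [mem_nonZeroDivisors_iff_right]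
    intro q hq
    obtain ⟨f, rfl⟩ := Ideal.Quotient.mk_surjective q
    rw [← map_mul, Ideal.Quotient.eq_zero_iff_mem, Ideal.mem_comap, mul_comm, map_mul, map_sub,
      rename_X, rename_X] at hq
    rw [Ideal.Quotient.eq_zero_iff_mem, Ideal.mem_comap]
    refine (hc.comp (truncateColour k (m + 1))).mem_of_X_sub_X_mul
      (a := Fin.last (m + 1)) (b := (0 : Fin (m + 1)).castSucc) ?_ hq
    exact (Fin.castSucc_lt_last _).ne'

lemma isIteratedSeparation_splitComplex {Δ : SimplicialComplexOn V} {i : V} {k : ℕ}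
    {c : Finset V → Fin (k + 1)} (hc : IsSeparating Δ i c)
    (hsurj : 0 < k → ∀ l, ∃ N ∈ minimalNonfaces Δ, i ∈ N ∧ c N = l) :
    IsIteratedSeparation (stanleyReisnerIdeal K Δ) i k
      (stanleyReisnerIdeal K (splitComplex Δ i c)) := by
  refine ⟨fun m => squarefreeIdeal K (splitFamily Δ i (truncateColour k m ∘ c)), ?_,
    fun m hm => isSeparation_splitFamily hm hc (hsurj (by omega)), ?_⟩
  · have hrel : relabelVertex i = splitVertex i (0 : Fin 1) := rfl
    have hinj : Function.Injective (splitVertex i (0 : Fin 1)) := by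
      intro v w h
      unfold splitVertex at h
      split_ifs at h with h1 h2 h2
      · exact h1.trans h2.symm
      · exact congrArg Subtype.val (Sum.inl_injective h)
    rw [stanleyReisnerIdeal_eq_squarefreeIdeal, hrel,
      map_rename_squarefreeIdeal _ fun _ _ => hinj.injOn]
    refine congrArg (squarefreeIdeal K) (Set.image_congr fun N _ => ?_)
    -- At `m = 0` only one colour is left, so splitting is mere relabelling; at `m = k` truncation
    -- changes nothing.
    have h0 : (truncateColour k 0 ∘ c) N = (0 : Fin 1) := Subsingleton.elim (α := Fin 1) _ _
    rw [splitSet, h0]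
  · rw [stanleyReisnerIdeal_splitComplex]
    refine congrArg (fun c => squarefreeIdeal K (splitFamily Δ i c)) (funext fun N => ?_)
    have : (c N : ℕ) ≤ k := Nat.lt_succ_iff.mp (c N).2
    simp [truncateColour, this]

end Assembly
end

theorem mainTheorem8 {K : Type*} [Field K] {n : ℕ} (Δ : SimplicialComplexOn (Fin n)) (i : Fin n)
    (k : ℕ)
    (hk : Module.rank K (T1Degree (stanleyReisnerIdeal K Δ) (-Pi.single i 1)) = (k : Cardinal)) :
    ∃ Δ' : SimplicialComplexOn (SplitVertices i k),
      IsIteratedSeparation (stanleyReisnerIdeal K Δ) i k (stanleyReisnerIdeal K Δ') ∧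
      RingTheory.Sequence.IsWeaklyRegular (StanleyReisnerRing K Δ')
        (differenceSequence K i k Δ') ∧
      ((∅ : Finset (Fin n)) ∈ Δ →
        RingTheory.Sequence.IsRegular (StanleyReisnerRing K Δ')
          (differenceSequence K i k Δ')) ∧
      (∃ e : (StanleyReisnerRing K Δ' ⧸ Ideal.ofList (differenceSequence K i k Δ')) ≃ₐ[K]
          StanleyReisnerRing K Δ,
        ∀ v : SplitVertices i k,
          e (Ideal.Quotient.mk (Ideal.ofList (differenceSequence K i k Δ'))
              (Ideal.Quotient.mk (stanleyReisnerIdeal K Δ') (X v))) =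
            Ideal.Quotient.mk (stanleyReisnerIdeal K Δ) (X (collapseVertex i k v))) ∧
      ∀ b : SplitVertices i k → ℕ, (∀ j : {j : Fin n // j ≠ i}, b (Sum.inl j) = 0) →
        T1Degree (stanleyReisnerIdeal K Δ') (fun v => -(b v : ℤ)) = ⊥ := by
  obtain ⟨c, hsep, hconn, hsurj⟩ := exists_separating_colouring Δ i hk
  refine ⟨splitComplex Δ i c, isIteratedSeparation_splitComplex hsep hsurj,
    isWeaklyRegular_differenceSequence hsep, isRegular_differenceSequence hsep,
    exists_algEquiv_collapse Δ i c, fun b hb => ?_⟩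
  rw [stanleyReisnerIdeal_splitComplex]
  exact T1Degree_splitFamily_eq_bot hsep hconn b hb
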